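/- **Setting.** Let $\varphi^i$, $i\in\{1,\dots,n\}$, be coordinates of Grassmann parity $\varepsilon_i\in\mathbb Z/2$: $p$ even ones and $q$ odd ones, $n=p+q$. Let $U\subseteq\mathbb R^p$ be open. A *superfunction* on $U$ is an element of $C^\infty(U)\otimes\Lambda(\mathbb R^q)$, and its *body* is obtained by setting the odd coordinates to zero. The rank of a matrix of superfunctions at a point $x\in U$ is the rank of its body at $x$. Let there be given * an even superfunction $S_0$ on $U$ (the action), with right derivatives $T_i:=S_0\frac{\overleftarrow\partial}{\partial\varphi^i}$; * superfunctions $R^i{}_{\alpha_0}$ of parity $\varepsilon_i+\varepsilon_{\alpha_0}$ and $Z^{\alpha_0}{}_{\alpha_1}$ of parity $\varepsilon_{\alpha_0}+\varepsilon_{\alpha_1}$ on $U$, where $\alpha_0\in\{1,\dots,m_0\}$, $\alpha_1\in\{1,\dots,m_1\}$, and the parities $\varepsilon_{\alpha_0},\varepsilon_{\alpha_1}$ are arbitrary, such that the Noether identity $\sum_i T_i R^i{}_{\alpha_0}=0$ holds on $U$. Assume that there are integers $M_{-1},M_0\ge 0$ with $M_{-1}+M_0=n$ such that, at every point of the stationary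 surface (the set of points of $U$ where the bodies of all $T_i$ vanish), $$\operatorname{rank}\Big(\tfrac{\overrightarrow\partial}{\partial\varphi^i}S_0\tfrac{\overleftarrow\partial}{\partial\varphi^j}\Big)=M_{-1},\qquad \operatorname{rank}\big(R^i{}_{\alpha_0}\big)=M_0 .$$ **Proposition (an antisymmetric $B^{ij}_{\alpha_1}$ exists).** Let $B^{ij}_{\alpha_1}$ be superfunctions on $U$ of parity $\varepsilon_i+\varepsilon_j+\varepsilon_{\alpha_1}$ that satisfy the first-stage Noether identity $$\sum_{\alpha_0}R^i{}_{\alpha_0}Z^{\alpha_0}{}_{\alpha_1}=\sum_j T_j\,B^{ji}_{\alpha_1}\qquad\text{for all } i,\alpha_1 .$$ Then every point of $U$ has an open neighbourhood $V\subseteq U$ on which there are superfunctions $\tilde B^{ij}_{\alpha_1}$ of parity $\varepsilon_i+\varepsilon_j+\varepsilon_{\alpha_1}$ that are graded antisymmetric, $$\tilde B^{ij}_{\alpha_1}=-(-1)^{\varepsilon_i\varepsilon_j}\tilde B^{ji}_{\alpha_1},$$ and satisfy the same identity, $\sum_{\alpha_0}R^i{}_{\alpha_0}Z^{\alpha_0}{}_{\alpha_1}=\sum_j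 T_j\tilde B^{ji}_{\alpha_1}$ for all $i,\alpha_1$. -/

import Mathlib

open scoped ContDiff

noncomputable section

/-- The Grassmann algebra over `ℝ` on `q` generators. -/
abbrev Grassmann (q : ℕ) : Type := ExteriorAlgebra ℝ (Fin q → ℝ)

/-- The monomials in the Grassmann generators, as a basis indexed by sets of generators. -/
def grassmannBasis (q : ℕ) : Module.Basis (Finset (Fin q)) ℝ (Grassmann q) :=
  (Pi.basisFun ℝ (Fin q)).ExteriorAlgebra

/-- The Grassmann algebra is finite dimensional, so all norms give the same notion of smoothness.
We take the supremum norm of the coefficients of the Grassmann monomials. -/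
instance instNormedAddCommGroupGrassmann (q : ℕ) : NormedAddCommGroup (Grassmann q) :=
  NormedAddCommGroup.induced (Grassmann q) (Finset (Fin q) → ℝ)
    (grassmannBasis q).equivFun (grassmannBasis q).equivFun.injective

instance instNormedSpaceGrassmann (q : ℕ) : NormedSpace ℝ (Grassmann q) :=
  NormedSpace.induced ℝ (Grassmann q) (Finset (Fin q) → ℝ) (grassmannBasis q).equivFun

/-- The index set of the fields `φ^i`: `p` even coordinates and `q` odd ones. -/
abbrev FieldIndex (p q : ℕ) : Type := Fin p ⊕ Fin q

/-- The Grassmann parity `ε_i` of the field `φ^i`. -/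
def fieldParity {p q : ℕ} : FieldIndex p q → ZMod 2 :=
  Sum.elim (fun _ => 0) (fun _ => 1)

/-- The sign `(-1)^{ε ε'}`. -/
def koszulSign (ε ε' : ZMod 2) : ℝ := (-1) ^ (ε * ε').val

/-- `f` is a smooth function of Grassmann parity `ε` on the superdomain over `U ⊆ ℝ^p` with `q`
odd coordinates, that is, a section over `U` of the parity `ε` part of `C^∞ ⊗ Λ(ℝ^q)`. Only the
values of `f` on `U` matter. -/
structure IsSuperFunctionOn {p q : ℕ} (U : Set (Fin p → ℝ)) (ε : ZMod 2)
    (f : (Fin p → ℝ) → Grassmann q) : Prop where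
  smooth : ContDiffOn ℝ ∞ f U
  parity : ∀ x ∈ U, f x ∈ CliffordAlgebra.evenOdd (0 : QuadraticForm ℝ (Fin q → ℝ)) ε

/-- The right derivative of `f` with respect to `φ^i`. -/
def rightDeriv {p q : ℕ} (i : FieldIndex p q) (f : (Fin p → ℝ) → Grassmann q) :
    (Fin p → ℝ) → Grassmann q := fun x =>
  match i with
  | Sum.inl k => fderiv ℝ f x (Pi.single k 1)
  | Sum.inr a => CliffordAlgebra.contractRight (f x) (LinearMap.proj a)

/-- The left derivative of `f` with respect to `φ^i`. -/
def leftDeriv {p q : ℕ} (i : FieldIndex p q) (f : (Fin p → ℝ) → Grassmann q) :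
    (Fin p → ℝ) → Grassmann q := fun x =>
  match i with
  | Sum.inl k => fderiv ℝ f x (Pi.single k 1)
  | Sum.inr a => CliffordAlgebra.contractLeft (LinearMap.proj a) (f x)

/-- The body of an element of the Grassmann algebra: all odd generators are put to zero. -/
def body {q : ℕ} (z : Grassmann q) : ℝ := ExteriorAlgebra.algebraMapInv z

/-- The stationary surface of `S₀` in `U`: the points at which all equations of motion hold. -/
def stationarySurface {p q : ℕ} (U : Set (Fin p → ℝ)) (S₀ : (Fin p → ℝ) → Grassmann q) :
    Set (Fin p → ℝ) :=
  {x | x ∈ U ∧ ∀ i : FieldIndex p q, body (rightDeriv i S₀ x) = 0}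

/-- The rank of a matrix of superfunctions at a point of the body: the rank of its body. -/
def superRankAt {p q : ℕ} {ι κ : Type} [Fintype κ]
    (A : ι → κ → (Fin p → ℝ) → Grassmann q) (x : Fin p → ℝ) : ℕ :=
  (Matrix.of fun i j => body (A i j x)).rank

/-- The Hessian `(∂/∂φ^i)^left S₀ (∂/∂φ^j)^right`. -/
def superHessian {p q : ℕ} (S₀ : (Fin p → ℝ) → Grassmann q) :
    FieldIndex p q → FieldIndex p q → (Fin p → ℝ) → Grassmann q :=
  fun i j => leftDeriv i (rightDeriv j S₀)

/-- The Noether identity `(S₀ ∂/∂φ^i) R^i_α = 0` on `U`. -/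
def NoetherIdentity {p q m₀ : ℕ} (U : Set (Fin p → ℝ)) (S₀ : (Fin p → ℝ) → Grassmann q)
    (R : FieldIndex p q → Fin m₀ → (Fin p → ℝ) → Grassmann q) : Prop :=
  ∀ x ∈ U, ∀ α, ∑ i, rightDeriv i S₀ x * R i α x = 0

/-- The first-stage Noether identity `R^i_α Z^α_β = (S₀ ∂/∂φ^j) B^{ji}_β` on `U`. -/
def FirstStageNoetherIdentity {p q m₀ m₁ : ℕ} (U : Set (Fin p → ℝ))
    (S₀ : (Fin p → ℝ) → Grassmann q)
    (R : FieldIndex p q → Fin m₀ → (Fin p → ℝ) → Grassmann q)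
    (Z : Fin m₀ → Fin m₁ → (Fin p → ℝ) → Grassmann q)
    (B : FieldIndex p q → FieldIndex p q → Fin m₁ → (Fin p → ℝ) → Grassmann q) : Prop :=
  ∀ x ∈ U, ∀ i β, ∑ α, R i α x * Z α β x = ∑ j, rightDeriv j S₀ x * B j i β x

/-- `B^{ij}_β` is a smooth structure function on `U`, of Grassmann parity `ε_i + ε_j + ε_β`. -/
def IsBStructureFunctionOn {p q m₁ : ℕ} (U : Set (Fin p → ℝ)) (ε₁ : Fin m₁ → ZMod 2)
    (B : FieldIndex p q → FieldIndex p q → Fin m₁ → (Fin p → ℝ) → Grassmann q) : Prop :=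
  ∀ i j β, IsSuperFunctionOn U (fieldParity i + fieldParity j + ε₁ β) (B i j β)

/-- Graded antisymmetry `B^{ij}_β = -(-1)^{ε_i ε_j} B^{ji}_β` on `U`. -/
def IsGradedAntisymmOn {p q m₁ : ℕ} (U : Set (Fin p → ℝ))
    (B : FieldIndex p q → FieldIndex p q → Fin m₁ → (Fin p → ℝ) → Grassmann q) : Prop :=
  ∀ x ∈ U, ∀ i j β,
    B i j β x = -(koszulSign (fieldParity i) (fieldParity j) • B j i β x)

end

noncomputable section

/-! Fix $\alpha_1$ and put $w^i=\sum R^i{}_{\alpha_0}Z^{\alpha_0}{}_{\alpha_1}$. The Noether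
identity gives $\sum T_iw^i=0$, so $w$ is a cycle in the Koszul complex of the $T_i$, and an
antisymmetric $\tilde B$ is a Koszul primitive of it. The full complex need not be exact, since the
$T_i$ are dependent. It suffices to have a subset $s$ of indices such that the complex of the $T_j$,
$j\in s$, is exact and these $T_j$ generate all $T_a$. As every $w^a$ lies in the ideal of the $T_j$
(this is where $B$ enters), the components outside $s$ can be absorbed into a correction of those
inside: `IsKoszulExact.exists_isGradedAntisymm`. Projecting onto the right parity finishes
(`exists_antisymm_structureFunction`).

Off the stationary surface some $T_k$ is invertible nearby and $s=\{k\}$ works. At a stationary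
point, differentiating the Noether identity gives Hessian times $R$ equal to zero on bodies. The
ranks are complementary, so the kernel of the Hessian is the image of $R$. Hence there is an $s$ for
which the Hessian columns in $s$ and the rows of $R$ outside $s$ are independent
(`exists_complementary_minors`). The rows of $R$ let the Noether identity be solved for the $T_a$,
$a\notin s$ (`exists_generation_of_relations`).

The columns say that the $T_j$, $j\in s$, have independent differentials, which gives local
exactness (`exists_koszulExact_of_independent`). Filtering by Grassmann degree reduces it to leading
terms (`IsKoszulExact.of_leading`): bodies of the even $T_j$, linear parts of the odd ones. The
bodies become coordinates after a change of variables, and an integral along rays is a primitive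
(`exists_koszul_primitive`). The odd linear parts are adjoined one by one by contraction with dual
covectors (`IsKoszulExact.insert_odd`). -/

theorem koszulSign_comm (a b : ZMod 2) : koszulSign a b = koszulSign b a := by
  simp only [koszulSign, mul_comm]

theorem koszulSign_mul_self (a b : ZMod 2) : koszulSign a b * koszulSign a b = 1 := by
  rw [koszulSign, ← mul_pow]; simp

theorem koszulSign_smul_smul {M : Type*} [AddCommGroup M] [Module ℝ M] (a b : ZMod 2) (x : M) :
    koszulSign a b • koszulSign a b • x = x := by
  rw [smul_smul, koszulSign_mul_self, one_smul]

theorem koszulSign_one_one : koszulSign 1 1 = -1 := by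
  have : ((1 : ZMod 2) * 1).val = 1 := by decide
  rw [koszulSign, this, pow_one]

theorem koszulSign_zero_left (b : ZMod 2) : koszulSign 0 b = 1 := by
  simp [koszulSign]

/-! ### Koszul complexes in degree one over a noncommutative algebra. -/

section Koszul

variable {A ι : Type*} [Ring A] [Algebra ℝ A]

/-- Graded antisymmetry of a matrix with respect to the parities `ε` of its indices. -/
def IsGradedAntisymm (ε : ι → ZMod 2) (C : ι → ι → A) : Prop :=
  ∀ i j, C i j = -(koszulSign (ε i) (ε j) • C j i)

/-- Exactness in degree one of the Koszul complex of the elements `T i`, `i ∈ s`. -/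
def IsKoszulExact (ε : ι → ZMod 2) (T : ι → A) (s : Finset ι) : Prop :=
  ∀ u : ι → A, ∑ i ∈ s, T i * u i = 0 →
    ∃ C : ι → ι → A, IsGradedAntisymm ε C ∧ ∀ i ∈ s, u i = ∑ j ∈ s, T j * C j i

theorem IsGradedAntisymm.add {ε : ι → ZMod 2} {C D : ι → ι → A} (hC : IsGradedAntisymm ε C)
    (hD : IsGradedAntisymm ε D) : IsGradedAntisymm ε (C + D) := by
  intro i j
  simp only [Pi.add_apply, smul_add, neg_add]
  rw [hC i j, hD i j]

theorem isGradedAntisymm_zero (ε : ι → ZMod 2) :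
    IsGradedAntisymm ε (0 : ι → ι → A) := by
  intro i j; simp

/-- Exchanging `i` and `j` reverses the sum: the two Koszul signs cancel and the minus sign of
antisymmetry remains. This is the vanishing of the square of the Koszul differential. -/
theorem IsGradedAntisymm.sum_mul_mul_eq_zero {ε : ι → ZMod 2} {C : ι → ι → A}
    (hC : IsGradedAntisymm ε C) {T : ι → A} {s : Finset ι}
    (hcomm : ∀ i ∈ s, ∀ j ∈ s, T i * T j = koszulSign (ε i) (ε j) • (T j * T i)) :
    ∑ i ∈ s, ∑ j ∈ s, T i * T j * C j i = 0 := by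
  have h : ∑ i ∈ s, ∑ j ∈ s, T i * T j * C j i = -∑ i ∈ s, ∑ j ∈ s, T i * T j * C j i := by
    conv_rhs => rw [Finset.sum_comm]
    simp only [← Finset.sum_neg_distrib]
    refine Finset.sum_congr rfl fun i hi => Finset.sum_congr rfl fun j hj => ?_
    rw [hC j i, hcomm i hi j hj, mul_neg, smul_mul_assoc, mul_smul_comm, koszulSign_comm (ε j),
      koszulSign_smul_smul]
  refine (smul_eq_zero_iff_right (two_ne_zero (α := ℝ))).1 ?_
  rw [two_smul]
  exact eq_neg_iff_add_eq_zero.1 h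

/-- Adjoining an odd element `T k` on which a graded derivation `D` with `D (T i) = 0`, `i ∈ s`,
takes the value one. -/
theorem IsKoszulExact.insert_odd [DecidableEq ι] {ε : ι → ZMod 2} {T : ι → A} {s : Finset ι} {k : ι}
    (hs : IsKoszulExact ε T s) (hk : k ∉ s)
    (hεk : ε k = 1) (hcomm : ∀ i ∈ s, T k * T i = koszulSign (ε k) (ε i) • (T i * T k))
    (hsq : T k * T k = 0) (D : A →+ A)
    (hD : ∀ i ∈ s, ∀ c, ∃ c', D (T i * c) = T i * c')
    (hDk : ∀ c, D (T k * c) = c - T k * D c) :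
    IsKoszulExact ε T (insert k s) := by
  intro u hu
  rw [Finset.sum_insert hk] at hu
  have h1 : ∀ i, ∃ c', i ∈ s → D (T i * u i) = T i * c' := fun i => by
    by_cases hi : i ∈ s
    · obtain ⟨c', h⟩ := hD i hi (u i); exact ⟨c', fun _ => h⟩
    · exact ⟨0, fun h => absurd h hi⟩
  choose b hb using h1
  -- Applying `D` to the relation solves it for `u k`, up to a multiple of `T k` and elements of the
  -- ideal of the other `T i`.
  have h2 := congrArg D hu
  rw [map_add, map_sum, Finset.sum_congr rfl hb, hDk, map_zero] at h2
  set d := D (u k)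
  have huk : u k = T k * d - ∑ i ∈ s, T i * b i := by
    rw [← sub_eq_zero, ← h2]; abel
  -- Since `T k` squares to zero, the unknown `d` drops out of `T k * u k`, and a relation among the
  -- `T i`, `i ∈ s`, is left.
  have h3 : ∑ i ∈ s, T i * (u i - koszulSign (ε k) (ε i) • (T k * b i)) = 0 := by
    rw [← hu, huk, mul_sub, ← mul_assoc, hsq, zero_mul, zero_sub, Finset.mul_sum, neg_add_eq_sub,
      ← Finset.sum_sub_distrib]
    refine Finset.sum_congr rfl fun i hi => ?_
    rw [mul_sub, ← mul_assoc (T k), hcomm i hi, mul_smul_comm, smul_mul_assoc, mul_assoc]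
  obtain ⟨C, hC, hCu⟩ := hs _ h3
  -- The diagonal entry `d` is allowed because `k` is odd: there graded antisymmetry imposes no
  -- condition.
  refine ⟨fun i j => if i = k then (if j = k then d else koszulSign (ε k) (ε j) • b j)
    else if j = k then -b i else C i j, ?_, ?_⟩
  · intro i j
    by_cases hi : i = k <;> by_cases hj : j = k
    · subst hi; subst hj; simp [hεk, koszulSign_one_one]
    · subst hi; simp [hj]
    · subst hj
      simp only [hi, if_false, if_true]
      rw [koszulSign_comm, koszulSign_smul_smul]
    · simp only [hi, hj, if_false]; exact hC i j
  · intro i hi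
    have hne : ∀ j ∈ s, j ≠ k := fun j hj h => hk (h ▸ hj)
    rw [Finset.sum_insert hk]
    rcases Finset.mem_insert.1 hi with rfl | hi
    · rw [huk]
      simp only [if_true]
      rw [sub_eq_add_neg, ← Finset.sum_neg_distrib]
      congr 1
      refine Finset.sum_congr rfl fun j hj => ?_
      rw [if_neg (hne j hj), mul_neg]
    · simp only [if_true, if_neg (hne i hi), mul_smul_comm]
      rw [Finset.sum_congr rfl fun j hj => by rw [if_neg (hne j hj)], ← hCu i hi]
      abel

/-- The projections onto the homogeneous components of a bounded, non-negative grading. -/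
structure IsDegreeProjection (Q : ℤ → A →ₗ[ℝ] A) : Prop where
  proj_proj : ∀ d e z, Q d (Q e z) = if d = e then Q e z else 0
  proj_neg : ∀ d < 0, ∀ z, Q d z = 0
  separated : ∃ N, ∀ z, (∀ d < N, Q d z = 0) → z = 0
  proj_mul : ∀ w d z c, Q w z = z → Q d (z * c) = z * Q (d - w) c
  filtered : ∀ a b z c, (∀ e < a, Q e z = 0) → (∀ e < b, Q e c = 0) → ∀ e < a + b, Q e (z * c) = 0

/-- Koszul exactness for the leading terms `T₀` implies Koszul exactness for `T`. -/
theorem IsKoszulExact.of_leading {ε : ι → ZMod 2} {T T₀ : ι → A} {s : Finset ι}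
    {Q : ℤ → A →ₗ[ℝ] A} (hQ : IsDegreeProjection Q) (w : ι → ℤ)
    (hw₀ : ∀ i, 0 ≤ w i) (hw : ∀ i, w i ≤ 1)
    (hcomm : ∀ i ∈ s, ∀ j ∈ s, T i * T j = koszulSign (ε i) (ε j) • (T j * T i))
    (hT₀ : ∀ i ∈ s, Q (w i) (T₀ i) = T₀ i) (hT : ∀ i ∈ s, ∀ e ≤ w i, Q e (T i - T₀ i) = 0)
    (h₀ : IsKoszulExact ε T₀ s) : IsKoszulExact ε T s := by
  obtain ⟨N, hN⟩ := hQ.separated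
  -- Here `u i` starts in degree `k - w i`, so each `T i * u i` starts in degree `k`. The number `n`
  -- bounds the remaining steps; once `k ≥ N + 1`, the bound `w i ≤ 1` forces `u i = 0`.
  have key : ∀ n : ℕ, ∀ k : ℤ, N + 1 ≤ k + n → ∀ u : ι → A,
      (∀ i ∈ s, ∀ e < k - w i, Q e (u i) = 0) → ∑ i ∈ s, T i * u i = 0 →
      ∃ C : ι → ι → A, IsGradedAntisymm ε C ∧ ∀ i ∈ s, u i = ∑ j ∈ s, T j * C j i := by
    intro n
    induction n with
    | zero =>
      intro k hk u hu _
      refine ⟨0, isGradedAntisymm_zero ε, fun i hi => ?_⟩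
      rw [hN (u i) fun d hd => hu i hi d ?_]
      · simp
      · have := hw i
        push_cast at hk
        linarith
    | succ n ih =>
      intro k hk u hu hsum
      have h1 : ∑ i ∈ s, T₀ i * Q (k - w i) (u i) = 0 := by
        have h := congrArg (Q k) hsum
        rw [map_sum, map_zero] at h
        rw [← h]
        refine Finset.sum_congr rfl fun i hi => ?_
        rw [← hQ.proj_mul _ _ _ _ (hT₀ i hi)]
        rw [eq_comm, ← sub_eq_zero, ← map_sub, ← sub_mul]
        exact hQ.filtered (w i + 1) (k - w i) _ _ (fun e he => hT i hi e (by linarith)) (hu i hi)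
          _ (by linarith)
      obtain ⟨C', hC', hCu⟩ := h₀ _ h1
      -- Keeping only this degree makes `T₀ j * C j i` homogeneous of degree `k - w i`; the degree
      -- is symmetric in `i` and `j`, so antisymmetry survives.
      set C : ι → ι → A := fun i j => Q (k - w i - w j) (C' i j) with hCdef
      have hC : IsGradedAntisymm ε C := fun i j => by
        simp only [hCdef]
        rw [hC' i j, map_neg, map_smul, sub_right_comm]
      have hlead : ∀ i ∈ s, Q (k - w i) (u i) = ∑ j ∈ s, T₀ j * C j i := fun i hi => by
        have h := congrArg (Q (k - w i)) (hCu i hi)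
        rw [hQ.proj_proj, if_pos rfl, map_sum] at h
        rw [h]
        refine Finset.sum_congr rfl fun j hj => ?_
        rw [hQ.proj_mul _ _ _ _ (hT₀ j hj), sub_right_comm]
      have hu' : ∀ i ∈ s, ∀ e < k + 1 - w i, Q e (u i - ∑ j ∈ s, T j * C j i) = 0 := by
        intro i hi e he
        have h2 : u i - ∑ j ∈ s, T j * C j i =
            (u i - Q (k - w i) (u i)) - ∑ j ∈ s, (T j - T₀ j) * C j i := by
          rw [hlead i hi]
          simp only [sub_mul, Finset.sum_sub_distrib]
          abel
        rw [h2, map_sub, map_sum, map_sub, hQ.proj_proj]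
        have h3 : ∑ j ∈ s, Q e ((T j - T₀ j) * C j i) = 0 := by
          refine Finset.sum_eq_zero fun j hj => ?_
          refine hQ.filtered (w j + 1) (k - w j - w i) _ _
            (fun e he => hT j hj e (by linarith)) (fun e he => ?_) _ (by linarith)
          rw [hCdef, hQ.proj_proj, if_neg he.ne]
        rw [h3, sub_zero]
        split_ifs with h
        · rw [h, sub_self]
        · rw [hu i hi e (lt_of_le_of_ne (by linarith) h), sub_zero]
      -- The subtracted term is a boundary for the full `T`, not just for `T₀`, so the remainder is
      -- again a cycle, of order one higher.
      have hsum' : ∑ i ∈ s, T i * (u i - ∑ j ∈ s, T j * C j i) = 0 := by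
        simp only [mul_sub, Finset.sum_sub_distrib, Finset.mul_sum, hsum, zero_sub, neg_eq_zero,
          ← mul_assoc]
        exact hC.sum_mul_mul_eq_zero hcomm
      obtain ⟨C₂, hC₂, hC₂u⟩ := ih (k + 1) (by push_cast at hk; linarith)
        (fun i => u i - ∑ j ∈ s, T j * C j i) hu' hsum'
      refine ⟨C + C₂, hC.add hC₂, fun i hi => ?_⟩
      simp only [Pi.add_apply, mul_add, Finset.sum_add_distrib]
      rw [← hC₂u i hi]; abel
  intro u hu
  refine key (N + 1).toNat 0 (by have := Int.self_le_toNat (N+1); linarith) u (fun i _ e he => ?_) hu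
  exact hQ.proj_neg e (by linarith [hw₀ i]) _

/-- If all `T i` lie in the right ideal of the `T j`, `j ∈ s`, whose Koszul complex is exact, then
an element `w i = ∑ j, T j * B j i` of the kernel of `∑ i, T i * w i` is of this form with a graded
antisymmetric matrix. -/
theorem IsKoszulExact.exists_isGradedAntisymm [Fintype ι] [DecidableEq ι] {ε : ι → ZMod 2}
    {T : ι → A} {s : Finset ι} (hs : IsKoszulExact ε T s)
    (hcomm : ∀ i j, T i * T j = koszulSign (ε i) (ε j) • (T j * T i))
    (hgen : ∀ a ∉ s, ∃ K : ι → A, T a = ∑ j ∈ s, T j * K j)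
    {w : ι → A} (B : ι → ι → A) (hw : ∀ i, w i = ∑ j, T j * B j i) (hTw : ∑ i, T i * w i = 0) :
    ∃ C : ι → ι → A, IsGradedAntisymm ε C ∧ ∀ i, w i = ∑ j, T j * C j i := by
  have h1 : ∀ a, ∃ K : ι → A, a ∉ s → T a = ∑ j ∈ s, T j * K j := fun a => by
    by_cases ha : a ∈ s
    · exact ⟨0, fun h => absurd ha h⟩
    · obtain ⟨K, hK⟩ := hgen a ha; exact ⟨K, fun _ => hK⟩
  choose K hK using h1
  -- Substituting the expressions for `T b`, `b ∉ s`, leaves only the generators in `s`.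
  set B' : ι → ι → A := fun j a => B j a + ∑ b ∈ sᶜ, K b j * B b a with hB'
  have hwB' : ∀ a, w a = ∑ j ∈ s, T j * B' j a := fun a => by
    rw [hw a, ← Finset.sum_add_sum_compl s]
    simp only [hB', mul_add, Finset.sum_add_distrib, Finset.mul_sum]
    congr 1
    rw [Finset.sum_comm]
    refine Finset.sum_congr rfl fun b hb => ?_
    rw [hK b (Finset.mem_compl.1 hb), Finset.sum_mul]
    simp only [mul_assoc]
  -- The terms `T a * w a` with `a ∉ s` are moved into the components in `s` by commuting `T a` past
  -- `T i`.
  obtain ⟨C, hC, hCu⟩ := hs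
    (fun i => w i + ∑ a ∈ sᶜ, koszulSign (ε i) (ε a) • (T a * B' i a)) (by
      rw [← hTw, ← Finset.sum_add_sum_compl s]
      simp only [mul_add, Finset.sum_add_distrib, Finset.mul_sum]
      congr 1
      rw [Finset.sum_comm]
      refine Finset.sum_congr rfl fun a _ => ?_
      rw [hwB' a, Finset.mul_sum]
      refine Finset.sum_congr rfl fun i _ => ?_
      rw [mul_smul_comm, ← mul_assoc, ← mul_assoc, hcomm i a, smul_mul_assoc,
        koszulSign_smul_smul])
  -- The columns outside `s` are those of `B'`; antisymmetry dictates the transposed block, which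
  -- cancels exactly the correction just added.
  refine ⟨fun i j => if i ∈ s then (if j ∈ s then C i j else B' i j)
    else if j ∈ s then -(koszulSign (ε i) (ε j) • B' j i) else 0, fun i j => ?_, fun i => ?_⟩
  · by_cases hi : i ∈ s <;> by_cases hj : j ∈ s
    · simpa only [hi, hj, if_true] using hC i j
    · simp only [hi, hj, if_true, if_false]
      rw [koszulSign_comm, smul_neg, neg_neg, koszulSign_smul_smul]
    · simp only [hi, hj, if_true, if_false]
    · simp [hi, hj]
  · rw [← Finset.sum_add_sum_compl s]
    by_cases hi : i ∈ s
    · have h2 : ∑ j ∈ s, T j * C j i = w i + ∑ a ∈ sᶜ, koszulSign (ε i) (ε a) • (T a * B' i a) :=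
        (hCu i hi).symm
      rw [eq_sub_of_add_eq h2.symm, sub_eq_add_neg, ← Finset.sum_neg_distrib]
      congr 1
      · refine Finset.sum_congr rfl fun j hj => ?_
        simp only [if_pos hj, if_pos hi]
      · refine Finset.sum_congr rfl fun j hj => ?_
        simp only [if_neg (Finset.mem_compl.1 hj), if_pos hi, mul_neg, mul_smul_comm]
        rw [koszulSign_comm]
    · rw [hwB' i, ← add_zero (∑ j ∈ s, _)]
      congr 1
      · refine Finset.sum_congr rfl fun j hj => ?_
        simp only [if_pos hj, if_neg hi]
      · refine (Finset.sum_eq_zero fun j hj => ?_).symm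
        simp only [if_neg (Finset.mem_compl.1 hj), if_neg hi, mul_zero]

end Koszul

/-! ### The Grassmann algebra: body, linear part, degree and parity. -/

section Grassmann

variable {q : ℕ}

theorem body_mul (z c : Grassmann q) : body (z * c) = body z * body c := map_mul _ _ _

theorem body_ι (m : Fin q → ℝ) : body (ExteriorAlgebra.ι ℝ m) = 0 := by
  simp [body, ExteriorAlgebra.algebraMapInv]

theorem body_algebraMap (r : ℝ) : body (algebraMap ℝ (Grassmann q) r) = r :=
  ExteriorAlgebra.algebraMap_leftInverse _ r

/-- The body as a linear map. -/
def bodyLinear (q : ℕ) : Grassmann q →ₗ[ℝ] ℝ := ExteriorAlgebra.algebraMapInv.toLinearMap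

theorem bodyLinear_apply (z : Grassmann q) : bodyLinear q z = body z := rfl

theorem ιInv_ι (m : Fin q → ℝ) : ExteriorAlgebra.ιInv (ExteriorAlgebra.ι ℝ m) = m :=
  ExteriorAlgebra.ι_leftInverse m

section

variable {M : Type*} [AddCommGroup M] [Module ℝ M]

theorem ιInv_algebraMap (r : ℝ) :
    ExteriorAlgebra.ιInv (algebraMap ℝ (ExteriorAlgebra ℝ M) r) = 0 := by
  -- These are the instances in the definition of `ExteriorAlgebra.ιInv`; with them the `change`
  -- below holds by unfolding.
  let _ : Module ℝᵐᵒᵖ M := Module.compHom _ ((RingHom.id ℝ).fromOpposite mul_comm)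
  have _ : IsCentralScalar ℝ M := ⟨fun r m => rfl⟩
  change TrivSqZeroExt.snd (ExteriorAlgebra.toTrivSqZeroExt
    (algebraMap ℝ (ExteriorAlgebra ℝ M) r)) = 0
  rw [AlgHom.commutes]
  rfl

/-- The linear part is a derivation over the body, because both are the components of an algebra map
to the trivial square-zero extension. -/
theorem ιInv_mul (z c : ExteriorAlgebra ℝ M) : ExteriorAlgebra.ιInv (z * c) =
    ExteriorAlgebra.algebraMapInv z • ExteriorAlgebra.ιInv c +
      ExteriorAlgebra.algebraMapInv c • ExteriorAlgebra.ιInv z := by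
  let _ : Module ℝᵐᵒᵖ M := Module.compHom _ ((RingHom.id ℝ).fromOpposite mul_comm)
  have _ : IsCentralScalar ℝ M := ⟨fun r m => rfl⟩
  have hfst : ∀ z : ExteriorAlgebra ℝ M, TrivSqZeroExt.fst (ExteriorAlgebra.toTrivSqZeroExt z) =
      ExteriorAlgebra.algebraMapInv z := by
    intro z
    have : (TrivSqZeroExt.fstHom ℝ ℝ M).comp ExteriorAlgebra.toTrivSqZeroExt =
        (ExteriorAlgebra.algebraMapInv : ExteriorAlgebra ℝ M →ₐ[ℝ] ℝ) := by
      ext m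
      simp [ExteriorAlgebra.algebraMapInv]
    exact DFunLike.congr_fun this z
  change TrivSqZeroExt.snd (ExteriorAlgebra.toTrivSqZeroExt (z * c)) = _
  rw [map_mul, TrivSqZeroExt.snd_mul, hfst, hfst]
  rfl

end

theorem body_contractLeft (d : Module.Dual ℝ (Fin q → ℝ)) (z : Grassmann q) :
    body (CliffordAlgebra.contractLeft d z) = d (ExteriorAlgebra.ιInv z) := by
  -- The extra factor `c` lets the induction pass through products; `c = 1` recovers the claim.
  suffices h : ∀ c : Grassmann q, body (CliffordAlgebra.contractLeft d (z * c)) =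
      body z * body (CliffordAlgebra.contractLeft d c) + body c * d (ExteriorAlgebra.ιInv z) by
    simpa [body, CliffordAlgebra.contractLeft_one] using h 1
  induction z using ExteriorAlgebra.induction with
  | algebraMap r =>
    intro c
    rw [CliffordAlgebra.contractLeft_algebraMap_mul, body_mul, body_algebraMap, ιInv_algebraMap]
    simp
  | ι m =>
    intro c
    rw [CliffordAlgebra.contractLeft_ι_mul, ιInv_ι, body_ι, ← bodyLinear_apply, map_sub, map_smul,
      bodyLinear_apply, bodyLinear_apply, body_mul, body_ι, smul_eq_mul]
    ring
  | mul a b ha hb =>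
    intro c
    rw [mul_assoc, ha, hb, ιInv_mul, body_mul]
    change _ = _ + body c * d (body a • _ + body b • _)
    rw [body_mul]
    simp only [map_add, map_smul, smul_eq_mul]
    ring
  | add a b ha hb =>
    intro c
    rw [add_mul, map_add, ← bodyLinear_apply, map_add, bodyLinear_apply, bodyLinear_apply, ha, hb,
      ← bodyLinear_apply (a + b), map_add, map_add, map_add, bodyLinear_apply, bodyLinear_apply]
    ring

theorem body_of_mem_odd {z : Grassmann q}
    (hz : z ∈ CliffordAlgebra.evenOdd (0 : QuadraticForm ℝ (Fin q → ℝ)) 1) : body z = 0 := by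
  induction z, hz using CliffordAlgebra.odd_induction with
  | ι v => exact body_ι v
  | add x y _ _ hx hy => rw [← bodyLinear_apply, map_add, bodyLinear_apply, bodyLinear_apply, hx, hy,
      add_zero]
  | ι_mul_ι_mul a b x _ hx => rw [body_mul, hx, mul_zero]

/-- Together with `body_of_mem_odd` this makes the body of the Hessian block diagonal in the
parities. -/
theorem ιInv_of_mem_even {z : Grassmann q}
    (hz : z ∈ CliffordAlgebra.evenOdd (0 : QuadraticForm ℝ (Fin q → ℝ)) 0) :
    ExteriorAlgebra.ιInv z = 0 := by
  induction z, hz using CliffordAlgebra.even_induction with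
  | algebraMap r => exact ιInv_algebraMap r
  | add x y _ _ hx hy => rw [map_add, hx, hy, add_zero]
  | ι_mul_ι_mul a b x _ hx =>
    rw [mul_assoc, ιInv_mul, ιInv_mul, hx]
    simp [ExteriorAlgebra.algebraMapInv]

theorem commute_of_mem_even {z : Grassmann q}
    (hz : z ∈ CliffordAlgebra.evenOdd (0 : QuadraticForm ℝ (Fin q → ℝ)) 0) (c : Grassmann q) :
    Commute z c := by
  induction z, hz using CliffordAlgebra.even_induction with
  | algebraMap r => exact Algebra.commute_algebraMap_left r c
  | add x y _ _ hx hy => exact hx.add_left hy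
  | ι_mul_ι_mul a b x _ hx =>
    refine Commute.mul_left ?_ hx
    have key : ∀ x y : Fin q → ℝ, ExteriorAlgebra.ι ℝ x * ExteriorAlgebra.ι ℝ y =
        -(ExteriorAlgebra.ι ℝ y * ExteriorAlgebra.ι ℝ x) := fun x y =>
      eq_neg_of_add_eq_zero_left (ExteriorAlgebra.ι_add_mul_swap x y)
    clear hx
    induction c using ExteriorAlgebra.induction with
    | algebraMap r => exact Algebra.commute_algebraMap_right r _
    | ι m =>
      change _ * _ * _ = _ * (_ * _)
      rw [mul_assoc, key b m, mul_neg, ← mul_assoc, key a m, neg_mul, neg_neg, mul_assoc]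
    | mul a b ha hb => exact ha.mul_right hb
    | add a b ha hb => exact ha.add_right hb

theorem anticommute_of_mem_odd {z c : Grassmann q}
    (hz : z ∈ CliffordAlgebra.evenOdd (0 : QuadraticForm ℝ (Fin q → ℝ)) 1)
    (hc : c ∈ CliffordAlgebra.evenOdd (0 : QuadraticForm ℝ (Fin q → ℝ)) 1) :
    z * c = -(c * z) := by
  induction z, hz using CliffordAlgebra.odd_induction with
  | ι v =>
    induction c, hc using CliffordAlgebra.odd_induction with
    | ι w => exact eq_neg_of_add_eq_zero_left (ExteriorAlgebra.ι_add_mul_swap v w)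
    | add x y _ _ hx hy => rw [mul_add, add_mul, hx, hy, neg_add]
    | ι_mul_ι_mul a b x _ hx =>
      have h := commute_of_mem_even (CliffordAlgebra.ι_mul_ι_mem_evenOdd_zero 0 a b)
        (CliffordAlgebra.ι 0 v)
      rw [← mul_assoc, ← h.eq, mul_assoc, hx, mul_neg, ← mul_assoc]
  | add x y _ _ hx hy => rw [mul_add, add_mul, hx, hy, neg_add]
  | ι_mul_ι_mul a b x _ hx =>
    have h := commute_of_mem_even (CliffordAlgebra.ι_mul_ι_mem_evenOdd_zero 0 a b) c
    rw [mul_assoc, hx, mul_neg, ← mul_assoc, h.eq, mul_assoc]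

/-- Graded commutativity of the Grassmann algebra. -/
theorem mul_eq_koszulSign_smul {a b : ZMod 2} {z c : Grassmann q}
    (hz : z ∈ CliffordAlgebra.evenOdd (0 : QuadraticForm ℝ (Fin q → ℝ)) a)
    (hc : c ∈ CliffordAlgebra.evenOdd (0 : QuadraticForm ℝ (Fin q → ℝ)) b) :
    z * c = koszulSign a b • (c * z) := by
  have h : ∀ a : ZMod 2, a = 0 ∨ a = 1 := by decide
  rcases h a with rfl | rfl
  · rw [koszulSign_zero_left, one_smul]
    exact commute_of_mem_even hz c
  · rcases h b with rfl | rfl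
    · rw [koszulSign_comm, koszulSign_zero_left, one_smul]
      exact (commute_of_mem_even hc z).symm
    · rw [koszulSign_one_one, neg_one_smul]
      exact anticommute_of_mem_odd hz hc

theorem contractRight_mem_evenOdd {ε : ZMod 2} {z : Grassmann q}
    (hz : z ∈ CliffordAlgebra.evenOdd (0 : QuadraticForm ℝ (Fin q → ℝ)) ε)
    (d : Module.Dual ℝ (Fin q → ℝ)) :
    CliffordAlgebra.contractRight z d ∈
      CliffordAlgebra.evenOdd (0 : QuadraticForm ℝ (Fin q → ℝ)) (ε + 1) := by
  refine Submodule.iSup_induction (fun i : { n : ℕ // (n : ZMod 2) = ε } =>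
    LinearMap.range (CliffordAlgebra.ι (0 : QuadraticForm ℝ (Fin q → ℝ))) ^ (i : ℕ))
    (motive := fun z => CliffordAlgebra.contractRight z d ∈
      CliffordAlgebra.evenOdd (0 : QuadraticForm ℝ (Fin q → ℝ)) (ε + 1)) hz ?_ ?_ ?_
  · intro i z hz
    obtain ⟨n, hn⟩ := i
    subst hn
    change z ∈ _ ^ n at hz
    rename_i hz'
    clear hz'
    induction hz using Submodule.pow_induction_on_right' with
    | algebraMap r => rw [CliffordAlgebra.contractRight_algebraMap]; exact Submodule.zero_mem _
    | add x y i _ _ hx hy =>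
      rw [map_add, LinearMap.add_apply]
      exact Submodule.add_mem _ hx hy
    | mul_mem i x hx h m hm =>
      obtain ⟨m, rfl⟩ := hm
      rw [CliffordAlgebra.contractRight_mul_ι]
      have h2 : ((i + 1 : ℕ) : ZMod 2) + 1 = i := by
        push_cast
        rw [add_assoc, show (1 : ZMod 2) + 1 = 0 from rfl, add_zero]
      refine Submodule.sub_mem _ (Submodule.smul_mem _ _ ?_) ?_
      · rw [h2]
        exact Submodule.mem_iSup_of_mem ⟨i, rfl⟩ hx
      · push_cast
        exact SetLike.mul_mem_graded h (CliffordAlgebra.ι_mem_evenOdd_one 0 m)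
  · rw [LinearMap.map_zero₂]; exact Submodule.zero_mem _
  · intro x y hx hy
    rw [map_add, LinearMap.add_apply]
    exact Submodule.add_mem _ hx hy

instance instFiniteDimensionalGrassmann : FiniteDimensional ℝ (Grassmann q) :=
  Module.Finite.of_basis (grassmannBasis q)

/-- Multiplication in the Grassmann algebra as a continuous bilinear map. -/
def grassmannMul (q : ℕ) : Grassmann q →L[ℝ] Grassmann q →L[ℝ] Grassmann q :=
  (LinearMap.mul ℝ (Grassmann q)).toContinuousBilinearMap

theorem grassmannMul_apply (z c : Grassmann q) : grassmannMul q z c = z * c := rfl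

/-- The projection of the Grassmann algebra onto its part of degree `d`. -/
def degreeProj (q : ℕ) (d : ℤ) : Grassmann q →ₗ[ℝ] Grassmann q :=
  if 0 ≤ d then GradedAlgebra.proj (fun i : ℕ => ⋀[ℝ]^i (Fin q → ℝ)) d.toNat else 0

theorem degreeProj_of_neg {d : ℤ} (hd : d < 0) (z : Grassmann q) : degreeProj q d z = 0 := by
  rw [degreeProj, if_neg (not_le.2 hd), LinearMap.zero_apply]

theorem degreeProj_natCast (n : ℕ) (z : Grassmann q) : degreeProj q n z =
    (DirectSum.decompose (fun i : ℕ => ⋀[ℝ]^i (Fin q → ℝ)) z n : Grassmann q) := by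
  rw [degreeProj, if_pos (Int.natCast_nonneg n), Int.toNat_natCast, GradedAlgebra.proj_apply]

theorem degreeProj_of_mem {n : ℕ} {z : Grassmann q} (hz : z ∈ ⋀[ℝ]^n (Fin q → ℝ)) (d : ℤ) :
    degreeProj q d z = if d = n then z else 0 := by
  rcases lt_or_ge d 0 with hd | hd
  · rw [degreeProj_of_neg hd, if_neg (by omega)]
  · lift d to ℕ using hd
    rw [degreeProj_natCast]
    split_ifs with h
    · rw [Nat.cast_inj.1 h,
        DirectSum.decompose_of_mem_same (fun i : ℕ => ⋀[ℝ]^i (Fin q → ℝ)) hz]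
    · exact DirectSum.decompose_of_mem_ne (fun i : ℕ => ⋀[ℝ]^i (Fin q → ℝ)) hz fun h' => h (by rw [h'])

theorem degreeProj_mem (n : ℕ) (z : Grassmann q) :
    degreeProj q n z ∈ ⋀[ℝ]^n (Fin q → ℝ) := by
  rw [degreeProj_natCast]; exact SetLike.coe_mem _

theorem sum_degreeProj (z : Grassmann q) : ∃ s : Finset ℕ, ∑ n ∈ s, degreeProj q n z = z := by
  classical
  refine ⟨(DirectSum.decompose (fun i : ℕ => ⋀[ℝ]^i (Fin q → ℝ)) z).support, ?_⟩
  simp only [degreeProj_natCast]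
  exact DirectSum.sum_support_decompose (fun i : ℕ => ⋀[ℝ]^i (Fin q → ℝ)) z

theorem degreeProj_mul_of_mem {n : ℕ} {z : Grassmann q} (hz : z ∈ ⋀[ℝ]^n (Fin q → ℝ)) (d : ℤ)
    (c : Grassmann q) : degreeProj q d (z * c) = z * degreeProj q (d - n) c := by
  rcases lt_or_ge d 0 with hd | hd
  · rw [degreeProj_of_neg hd, degreeProj_of_neg (by omega), mul_zero]
  · lift d to ℕ using hd
    rw [degreeProj_natCast,
      DirectSum.coe_decompose_mul_of_left_mem (fun i : ℕ => ⋀[ℝ]^i (Fin q → ℝ)) _ hz]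
    split_ifs with h
    · rw [← Nat.cast_sub h, degreeProj_natCast]
    · rw [degreeProj_of_neg (by omega), mul_zero]

theorem isDegreeProjection_degreeProj (q : ℕ) : IsDegreeProjection (degreeProj q) where
  proj_neg := fun d hd z => degreeProj_of_neg hd z
  proj_proj := fun d e z => by
    rcases lt_or_ge e 0 with he | he
    · simp [degreeProj_of_neg he]
    · lift e to ℕ using he
      exact degreeProj_of_mem (degreeProj_mem e z) d
  separated := by
    -- Finitely many basis elements have finitely many homogeneous components; all degrees above
    -- theirs have zero projection.
    choose s hs using fun i => sum_degreeProj (grassmannBasis q i)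
    refine ⟨(Finset.univ.biUnion s).sup id + 1, fun z hz => ?_⟩
    obtain ⟨t, ht⟩ := sum_degreeProj z
    rw [← ht]
    refine Finset.sum_eq_zero fun n _ => ?_
    by_cases hn : (n : ℤ) < (Finset.univ.biUnion s).sup id + 1
    · exact hz _ (by exact_mod_cast hn)
    · have : degreeProj q n = 0 := by
        refine (grassmannBasis q).ext fun i => ?_
        rw [← hs i, map_sum, LinearMap.zero_apply]
        refine Finset.sum_eq_zero fun m hm => ?_
        rw [degreeProj_of_mem (degreeProj_mem m _), if_neg]
        intro h
        have h2 : m ≤ (Finset.univ.biUnion s).sup id :=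
          Finset.le_sup (f := id) (Finset.mem_biUnion.2 ⟨i, Finset.mem_univ _, hm⟩)
        omega
      rw [this, LinearMap.zero_apply]
  proj_mul := fun w d z c hz => by
    rcases lt_or_ge w 0 with hw | hw
    · rw [degreeProj_of_neg hw] at hz
      rw [← hz]; simp
    · lift w to ℕ using hw
      exact degreeProj_mul_of_mem (hz ▸ degreeProj_mem w z) d c
  filtered := fun a b z c hz hc e he => by
    obtain ⟨s, hs⟩ := sum_degreeProj z
    rw [← hs, Finset.sum_mul, map_sum]
    refine Finset.sum_eq_zero fun n _ => ?_
    rw [degreeProj_mul_of_mem (degreeProj_mem n z)]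
    by_cases h : (n : ℤ) < a
    · rw [hz n h, zero_mul]
    · rw [hc _ (by omega), mul_zero]

theorem body_ιInv_of_mem_pow_succ {n : ℕ} {z : Grassmann q}
    (hz : z ∈ ⋀[ℝ]^(n + 1) (Fin q → ℝ)) :
    body z = 0 ∧ (n ≠ 0 → ExteriorAlgebra.ιInv z = 0) := by
  induction n generalizing z with
  | zero =>
    rw [zero_add, ExteriorAlgebra.exteriorPower, pow_one] at hz
    obtain ⟨m, rfl⟩ := hz
    exact ⟨body_ι m, fun h => absurd rfl h⟩
  | succ n ih =>
    rw [ExteriorAlgebra.exteriorPower, pow_succ'] at hz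
    induction hz using Submodule.mul_induction_on' with
    | mem_mul_mem a ha b hb =>
      obtain ⟨m, rfl⟩ := ha
      have h1 : ExteriorAlgebra.algebraMapInv b = (0 : ℝ) := (ih hb).1
      have h2 : ExteriorAlgebra.algebraMapInv (ExteriorAlgebra.ι ℝ m) = (0 : ℝ) := body_ι m
      refine ⟨by rw [body_mul, body_ι, zero_mul], fun _ => ?_⟩
      rw [ιInv_mul, h1, h2, zero_smul, zero_smul, add_zero]
    | add x _ y _ hx hy =>
      refine ⟨?_, fun h => by rw [map_add, hx.2 h, hy.2 h, add_zero]⟩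
      rw [← bodyLinear_apply, map_add, bodyLinear_apply, bodyLinear_apply, hx.1, hy.1, add_zero]

theorem degreeProj_zero (z : Grassmann q) : degreeProj q 0 z = algebraMap ℝ _ (body z) := by
  suffices h : degreeProj q 0 = (Algebra.linearMap ℝ (Grassmann q)).comp (bodyLinear q) from
    DFunLike.congr_fun h z
  refine LinearMap.ext fun z => ?_
  obtain ⟨s, hs⟩ := sum_degreeProj z
  rw [← hs, map_sum, map_sum]
  refine Finset.sum_congr rfl fun n _ => ?_
  have hz := degreeProj_mem n z
  rw [degreeProj_of_mem hz]
  rcases n with _ | n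
  · obtain ⟨r, hr⟩ := Submodule.mem_one.1 (by simpa using hz)
    simp only [Nat.cast_zero, if_true] at hr ⊢
    rw [← hr, LinearMap.comp_apply, bodyLinear_apply, body_algebraMap, Algebra.linearMap_apply]
  · rw [if_neg (by omega), LinearMap.comp_apply, bodyLinear_apply,
      (body_ιInv_of_mem_pow_succ hz).1, map_zero]

theorem degreeProj_one (z : Grassmann q) :
    degreeProj q 1 z = ExteriorAlgebra.ι ℝ (ExteriorAlgebra.ιInv z) := by
  suffices h : degreeProj q 1 = (ExteriorAlgebra.ι ℝ).comp ExteriorAlgebra.ιInv from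
    DFunLike.congr_fun h z
  refine LinearMap.ext fun z => ?_
  obtain ⟨s, hs⟩ := sum_degreeProj z
  rw [← hs, map_sum, map_sum]
  refine Finset.sum_congr rfl fun n _ => ?_
  have hz := degreeProj_mem n z
  rw [degreeProj_of_mem hz]
  rcases n with _ | _ | n
  · obtain ⟨r, hr⟩ := Submodule.mem_one.1 (by simpa using hz)
    rw [if_neg (by simp)]
    simp only [Nat.cast_zero] at hr ⊢
    rw [← hr, LinearMap.comp_apply, ιInv_algebraMap, map_zero]
  · rw [ExteriorAlgebra.exteriorPower, zero_add, pow_one] at hz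
    obtain ⟨m, hm⟩ := hz
    rw [if_pos (by simp), zero_add, ← hm, LinearMap.comp_apply, ιInv_ι]
  · rw [if_neg (by omega), LinearMap.comp_apply, (body_ιInv_of_mem_pow_succ hz).2 (by omega),
      map_zero]

/-- The projection of the Grassmann algebra onto its part of parity `ε`. -/
def parityProj (q : ℕ) (ε : ZMod 2) : Grassmann q →ₗ[ℝ] Grassmann q :=
  GradedAlgebra.proj (CliffordAlgebra.evenOdd (0 : QuadraticForm ℝ (Fin q → ℝ))) ε

theorem parityProj_mem (ε : ZMod 2) (z : Grassmann q) :
    parityProj q ε z ∈ CliffordAlgebra.evenOdd (0 : QuadraticForm ℝ (Fin q → ℝ)) ε := by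
  rw [parityProj, GradedAlgebra.proj_apply]; exact SetLike.coe_mem _

theorem parityProj_of_mem {ε : ZMod 2} {z : Grassmann q}
    (hz : z ∈ CliffordAlgebra.evenOdd (0 : QuadraticForm ℝ (Fin q → ℝ)) ε) :
    parityProj q ε z = z := by
  rw [parityProj, GradedAlgebra.proj_apply, DirectSum.decompose_of_mem_same _ hz]

theorem parityProj_add_of_mem {ε : ZMod 2} {z : Grassmann q}
    (hz : z ∈ CliffordAlgebra.evenOdd (0 : QuadraticForm ℝ (Fin q → ℝ)) ε) :
    parityProj q (ε + 1) z = 0 := by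
  rw [parityProj, GradedAlgebra.proj_apply]
  refine DirectSum.decompose_of_mem_ne _ hz ?_
  clear hz
  revert ε
  decide

theorem mem_evenOdd_of_parityProj {ε : ZMod 2} {z : Grassmann q}
    (hz : parityProj q (ε + 1) z = 0) :
    z ∈ CliffordAlgebra.evenOdd (0 : QuadraticForm ℝ (Fin q → ℝ)) ε := by
  classical
  rw [← DirectSum.sum_support_decompose
    (CliffordAlgebra.evenOdd (0 : QuadraticForm ℝ (Fin q → ℝ))) z]
  refine Submodule.sum_mem _ fun i _ => ?_
  have h : ∀ i ε : ZMod 2, i = ε ∨ i = ε + 1 := by decide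
  rcases h i ε with rfl | rfl
  · exact SetLike.coe_mem _
  · rw [parityProj, GradedAlgebra.proj_apply] at hz
    rw [hz]
    exact Submodule.zero_mem _

theorem parityProj_mul_of_mem {a : ZMod 2} {z : Grassmann q}
    (hz : z ∈ CliffordAlgebra.evenOdd (0 : QuadraticForm ℝ (Fin q → ℝ)) a) (b : ZMod 2)
    (c : Grassmann q) : parityProj q (a + b) (z * c) = z * parityProj q b c := by
  rw [parityProj, GradedAlgebra.proj_apply, DirectSum.coe_decompose_mul_add_of_left_mem _ hz]
  rfl

end Grassmann

/-! ### Koszul primitives of smooth functions by integration along rays. -/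

section Analysis

variable {E : Type} [NormedAddCommGroup E] [NormedSpace ℝ E] [FiniteDimensional ℝ E]

/-- The derivative of an integral over `[0, 1]` with respect to a parameter. -/
theorem hasFDerivAt_integral_of_contDiffOn {G : Type} [NormedAddCommGroup G] [NormedSpace ℝ G]
    {O : Set (ℝ × E)} (hO : IsOpen O) {W : Set E} (hW : IsOpen W)
    (hOW : ∀ s ∈ Set.Icc (0 : ℝ) 1, ∀ x ∈ W, (s, x) ∈ O) {f : ℝ × E → G}
    (hf : ContDiffOn ℝ 1 f O) {x : E} (hx : x ∈ W) :
    HasFDerivAt (fun x => ∫ s in (0 : ℝ)..1, f (s, x))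
      (∫ s in (0 : ℝ)..1, (fderiv ℝ f (s, x)).comp (ContinuousLinearMap.inr ℝ ℝ E)) x := by
  have : ProperSpace E := FiniteDimensional.proper ℝ E
  set f' : ℝ × E → E →L[ℝ] G := fun z =>
    (fderiv ℝ f z).comp (ContinuousLinearMap.inr ℝ ℝ E) with hf'
  have hf'c : ContinuousOn f' O :=
    (hf.continuousOn_fderiv_of_isOpen hO le_rfl).clm_comp continuousOn_const
  obtain ⟨r, hr, hrW⟩ := Metric.nhds_basis_closedBall.mem_iff.1 (hW.mem_nhds hx)
  have hcomp : IsCompact (Set.Icc (0 : ℝ) 1 ×ˢ Metric.closedBall x r) :=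
    isCompact_Icc.prod (isCompact_closedBall x r)
  -- The partial derivative is bounded on this compact set, which supplies the constant dominating
  -- function.
  have hsub : Set.Icc (0 : ℝ) 1 ×ˢ Metric.closedBall x r ⊆ O := fun z hz =>
    hOW z.1 hz.1 z.2 (hrW hz.2)
  obtain ⟨M, hM⟩ := hcomp.exists_bound_of_continuousOn (hf'c.mono hsub)
  have hI : Set.uIcc (0 : ℝ) 1 = Set.Icc 0 1 := Set.uIcc_of_le zero_le_one
  have hI' : Set.uIoc (0 : ℝ) 1 ⊆ Set.Icc 0 1 := by
    rw [Set.uIoc_of_le zero_le_one]; exact Set.Ioc_subset_Icc_self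
  have hslice : ∀ {H : Type} [NormedAddCommGroup H] (g : ℝ × E → H), ContinuousOn g O → ∀ y ∈ W,
      ContinuousOn (fun s => g (s, y)) (Set.Icc 0 1) := fun g hg y hy =>
    hg.comp (by fun_prop) fun s hs => hOW s hs y hy
  refine intervalIntegral.hasFDerivAt_integral_of_dominated_of_fderiv_le
    (F := fun x s => f (s, x)) (F' := fun x s => f' (s, x)) (bound := fun _ => M)
    (Metric.closedBall_mem_nhds x hr) ?_ ?_ ?_ ?_ ?_ ?_
  · filter_upwards [hW.mem_nhds hx] with y hy
    exact ((hslice f hf.continuousOn y hy).mono hI').aestronglyMeasurable measurableSet_uIoc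
  · exact ContinuousOn.intervalIntegrable (hI ▸ hslice f hf.continuousOn x hx)
  · exact ((hslice f' hf'c x hx).mono hI').aestronglyMeasurable measurableSet_uIoc
  · exact Filter.Eventually.of_forall fun s hs y hy => hM (s, y) ⟨hI' hs, hy⟩
  · exact intervalIntegrable_const
  · refine Filter.Eventually.of_forall fun s hs y hy => ?_
    have h1 : HasFDerivAt f (fderiv ℝ f (s, y)) (s, y) :=
      ((hf.differentiableOn one_ne_zero).differentiableAt
        (hO.mem_nhds (hsub ⟨hI' hs, hy⟩))).hasFDerivAt
    exact h1.comp y (hasFDerivAt_prodMk_right s y)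

/-- The derivative is an integral of the same kind with values in linear maps, so the induction on
the order runs over all targets `G`. -/
theorem contDiffOn_integral_of_contDiffOn {G : Type} [NormedAddCommGroup G] [NormedSpace ℝ G]
    {O : Set (ℝ × E)} (hO : IsOpen O) {W : Set E} (hW : IsOpen W)
    (hOW : ∀ s ∈ Set.Icc (0 : ℝ) 1, ∀ x ∈ W, (s, x) ∈ O) {f : ℝ × E → G}
    (hf : ContDiffOn ℝ ∞ f O) :
    ContDiffOn ℝ ∞ (fun x => ∫ s in (0 : ℝ)..1, f (s, x)) W := by
  refine contDiffOn_infty.2 fun n => ?_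
  have hd : ∀ {G : Type} [NormedAddCommGroup G] [NormedSpace ℝ G] {f : ℝ × E → G},
      ContDiffOn ℝ ∞ f O → DifferentiableOn ℝ (fun x => ∫ s in (0 : ℝ)..1, f (s, x)) W :=
    fun hf x hx => (hasFDerivAt_integral_of_contDiffOn hO hW hOW (hf.of_le (by simp))
      hx).differentiableAt.differentiableWithinAt
  induction n generalizing G with
  | zero => exact contDiffOn_zero.2 (hd hf).continuousOn
  | succ n ih =>
    push_cast
    refine (contDiffOn_succ_iff_fderiv_of_isOpen hW).2 ⟨hd hf, fun h => by simp at h, ?_⟩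
    have hf' : ContDiffOn ℝ ∞
        (fun z => (fderiv ℝ f z).comp (ContinuousLinearMap.inr ℝ ℝ E)) O :=
      (hf.fderiv_of_isOpen hO (by simp)).clm_comp contDiffOn_const
    exact (ih hf').congr fun x hx =>
      (hasFDerivAt_integral_of_contDiffOn hO hW hOW (hf.of_le (by simp)) hx).fderiv

/-- Exactness in degree one, on suitable neighbourhoods, of the Koszul complex of independent
linear forms with values in smooth functions. -/
theorem exists_koszul_primitive_linear {ι : Type*} [DecidableEq ι] (s : Finset ι)
    (l : ι → E →L[ℝ] ℝ) (e : ι → E)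
    (hle : ∀ i ∈ s, ∀ j ∈ s, l i (e j) = if i = j then 1 else 0) {y₀ : E}
    (hy₀ : ∀ i ∈ s, l i y₀ = 0) {W₀ : Set E} (hW₀ : IsOpen W₀) (hyW : y₀ ∈ W₀) :
    ∃ W, IsOpen W ∧ y₀ ∈ W ∧ W ⊆ W₀ ∧
      ∀ {G : Type} [NormedAddCommGroup G] [NormedSpace ℝ G] [CompleteSpace G] (u : ι → E → G),
        (∀ i, ContDiffOn ℝ ∞ (u i) W) → (∀ y ∈ W, ∑ i ∈ s, l i y • u i y = 0) →
        ∃ C : ι → ι → E → G, (∀ i j, ContDiffOn ℝ ∞ (C i j) W) ∧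
          (∀ i j, ∀ y ∈ W, C i j y = -C j i y) ∧
          ∀ i ∈ s, ∀ y ∈ W, u i y = ∑ j ∈ s, l j y • C j i y := by
  obtain ⟨r, hr, hrW⟩ := Metric.isOpen_iff.1 hW₀ y₀ hyW
  -- `P` projects onto the span of the `e i`, along the common kernel of the `l i`.
  set P : E →L[ℝ] E := ∑ i ∈ s, (l i).smulRight (e i) with hP
  have hPy : ∀ y, P y = ∑ i ∈ s, l i y • e i := fun y => by
    simp [hP]
  have hlP : ∀ i ∈ s, ∀ y, l i (P y) = l i y := fun i hi y => by
    rw [hPy, map_sum, Finset.sum_eq_single_of_mem i hi]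
    · rw [map_smul, hle i hi i hi, if_pos rfl, smul_eq_mul, mul_one]
    · intro j hj hji
      rw [map_smul, hle i hi j hj, if_neg hji.symm, smul_zero]
  have hPP : ∀ y, P (P y) = P y := fun y => by
    rw [hPy (P y), hPy y]
    exact Finset.sum_congr rfl fun i hi => by rw [← hPy, hlP i hi]
  have hPy₀ : P y₀ = 0 := by
    rw [hPy]
    exact Finset.sum_eq_zero fun i hi => by rw [hy₀ i hi, zero_smul]
  -- This neighbourhood is stable under shrinking the `P`-component towards zero, and does not
  -- depend on `u`.
  set W : Set E := {y | ‖y - P y - y₀‖ < r / 2 ∧ ‖P y‖ < r / 2} with hW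
  have hWo : IsOpen W := (isOpen_lt (f := fun y => ‖y - P y - y₀‖) (by fun_prop)
    continuous_const).inter (isOpen_lt (f := fun y => ‖P y‖) (by fun_prop) continuous_const)
  -- The path scales every `l i` by `t` and fixes the transverse directions.
  set γ : ℝ × E → E := fun z => z.2 - (1 - z.1) • P z.2 with hγ
  have hγs : ContDiff ℝ ∞ γ := by
    simp only [hγ]
    fun_prop
  have hPγ : ∀ t y, P (γ (t, y)) = t • P y := fun t y => by
    simp only [hγ, map_sub, map_smul, hPP, sub_smul, one_smul]
    abel
  have hlγ : ∀ i ∈ s, ∀ t y, l i (γ (t, y)) = t * l i y := fun i hi t y => by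
    rw [← hlP i hi (γ (t, y)), hPγ, map_smul, hlP i hi, smul_eq_mul]
  have hγ1 : ∀ y, γ (1, y) = y := fun y => by simp [hγ]
  have hγW : ∀ t ∈ Set.Icc (0 : ℝ) 1, ∀ y ∈ W, γ (t, y) ∈ W := by
    rintro t ⟨h0, h1⟩ y ⟨hy1, hy2⟩
    refine ⟨?_, ?_⟩
    · rw [hPγ]
      have : γ (t, y) - t • P y - y₀ = y - P y - y₀ := by
        simp only [hγ, sub_smul, one_smul]; abel
      rwa [this]
    · rw [hPγ, norm_smul, Real.norm_of_nonneg h0]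
      exact lt_of_le_of_lt (mul_le_of_le_one_left (norm_nonneg _) h1) hy2
  refine ⟨W, hWo, ?_, ?_, ?_⟩
  · simp only [hW, Set.mem_ofPred_eq, hPy₀, sub_zero, sub_self, norm_zero]
    exact ⟨by linarith, by linarith⟩
  · rintro y ⟨hy1, hy2⟩
    refine hrW ?_
    rw [mem_ball_iff_norm]
    calc ‖y - y₀‖ = ‖(y - P y - y₀) + P y‖ := by congr 1; abel
      _ ≤ ‖y - P y - y₀‖ + ‖P y‖ := norm_add_le _ _
      _ < r := by linarith
  intro G _ _ _ u hu hsum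
  set O : Set (ℝ × E) := γ ⁻¹' W with hOdef
  have hO : IsOpen O := hWo.preimage hγs.continuous
  have hOW : ∀ t ∈ Set.Icc (0 : ℝ) 1, ∀ y ∈ W, (t, y) ∈ O := hγW
  -- The homotopy formula: the primitive is the integral over $t\in[0,1]$ of
  -- $t(\partial_iu_j-\partial_ju_i)$ along the ray.
  set F : ι → ι → ℝ × E → G := fun i j z =>
    z.1 • (fderiv ℝ (u j) (γ z) (e i) - fderiv ℝ (u i) (γ z) (e j)) with hF
  have hfd : ∀ i j, ContDiffOn ℝ ∞ (fun z => fderiv ℝ (u j) (γ z) (e i)) O := fun i j =>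
    (((hu j).fderiv_of_isOpen hWo (by simp)).comp hγs.contDiffOn fun z hz => hz).clm_apply
      contDiffOn_const
  have hFs : ∀ i j, ContDiffOn ℝ ∞ (F i j) O := fun i j =>
    contDiff_fst.contDiffOn.smul ((hfd i j).sub (hfd j i))
  have hslice : ∀ (g : ℝ × E → G), ContDiffOn ℝ ∞ g O → ∀ y ∈ W,
      IntervalIntegrable (fun t => g (t, y)) MeasureTheory.volume 0 1 := fun g hg y hy => by
    refine ContinuousOn.intervalIntegrable ?_
    rw [Set.uIcc_of_le zero_le_one]
    exact hg.continuousOn.comp (by fun_prop) fun t ht => hOW t ht y hy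
  have hud : ∀ i, ∀ y ∈ W, HasFDerivAt (u i) (fderiv ℝ (u i) y) y := fun i y hy =>
    (((hu i).differentiableOn (by simp)).differentiableAt (hWo.mem_nhds hy)).hasFDerivAt
  refine ⟨fun i j y => ∫ t in (0 : ℝ)..1, F i j (t, y),
    fun i j => contDiffOn_integral_of_contDiffOn hO hWo hOW (hFs i j), fun i j y _ => ?_,
    fun i hi y hy => ?_⟩
  · rw [← intervalIntegral.integral_neg]
    refine intervalIntegral.integral_congr fun t _ => ?_
    simp only [hF, ← smul_neg, neg_sub]
  -- Differentiating the relation along `e i` expresses `u i` through derivatives of the `u j`; this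
  -- turns the derivative of $t\,u_i(\gamma_t)$ into a combination of the integrands.
  · have hrel : ∀ z ∈ W, ∑ j ∈ s, l j z • fderiv ℝ (u j) z (e i) = -u i z := by
      intro z hz
      have h1 : HasFDerivAt (fun y => ∑ j ∈ s, l j y • u j y)
          (∑ j ∈ s, (l j z • fderiv ℝ (u j) z + (l j).smulRight (u j z))) z :=
        HasFDerivAt.fun_sum fun j _ => (l j).hasFDerivAt.smul (hud j z hz)
      have h2 : HasFDerivAt (fun y => ∑ j ∈ s, l j y • u j y) (0 : E →L[ℝ] G) z :=
        (hasFDerivAt_const (0 : G) z).congr_of_eventuallyEq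
          (by filter_upwards [hWo.mem_nhds hz] with y hy using hsum y hy)
      have h3 := DFunLike.congr_fun (h1.unique h2) (e i)
      simp only [sum_apply, add_apply,
        smul_apply, ContinuousLinearMap.smulRight_apply,
        Finset.sum_add_distrib, zero_apply] at h3
      rw [← add_eq_zero_iff_eq_neg, ← h3]
      congr 1
      rw [Finset.sum_eq_single_of_mem i hi, hle i hi i hi, if_pos rfl, one_smul]
      intro j hj hji
      rw [hle j hj i hi, if_neg hji, zero_smul]
    have hder : ∀ t ∈ Set.uIcc (0 : ℝ) 1, HasDerivAt (fun t => t • u i (γ (t, y)))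
        (∑ j ∈ s, l j y • F j i (t, y)) t := by
      intro t ht
      rw [Set.uIcc_of_le zero_le_one] at ht
      have hγt : HasDerivAt (fun t => γ (t, y)) (P y) t := by
        have : HasDerivAt (fun t : ℝ => y - (1 - t) • P y) (-((-1 : ℝ) • P y)) t :=
          (((hasDerivAt_id t).const_sub 1).smul_const (P y)).const_sub y
        simpa using this
      have h1 := (hasDerivAt_id t).smul ((hud i _ (hγW t ht y hy)).comp_hasDerivAt t hγt)
      refine h1.congr_deriv ?_
      simp only [hF, id, one_smul]
      have h2 : fderiv ℝ (u i) (γ (t, y)) (P y) =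
          ∑ j ∈ s, l j y • fderiv ℝ (u i) (γ (t, y)) (e j) := by
        rw [hPy, map_sum]
        simp only [map_smul]
      have h3 : u i (γ (t, y)) = -∑ j ∈ s, l j y • t • fderiv ℝ (u j) (γ (t, y)) (e i) := by
        rw [← neg_eq_iff_eq_neg, ← hrel _ (hγW t ht y hy)]
        refine Finset.sum_congr rfl fun j hj => ?_
        rw [hlγ j hj, smul_smul, mul_comm]
      simp only [Function.comp_apply]
      rw [h2, h3, Finset.smul_sum, ← Finset.sum_neg_distrib, ← Finset.sum_add_distrib]
      refine Finset.sum_congr rfl fun j _ => ?_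
      rw [smul_sub, smul_sub, smul_comm t (l j y), sub_eq_add_neg]
    have hint : ∀ j ∈ s, IntervalIntegrable (fun t => l j y • F j i (t, y))
        MeasureTheory.volume 0 1 := fun j _ => (hslice _ (hFs j i) y hy).smul _
    have h4 := intervalIntegral.integral_eq_sub_of_hasDerivAt hder
      (by simpa only [Finset.sum_fn] using IntervalIntegrable.sum s hint)
    rw [intervalIntegral.integral_finsetSum hint] at h4
    simp only [intervalIntegral.integral_smul, one_smul, zero_smul, sub_zero, hγ1] at h4
    exact h4.symm

/-- Exactness in degree one, on suitable neighbourhoods, of the Koszul complex of functions with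
independent differentials at a common zero, with values in smooth functions. -/
theorem exists_koszul_primitive {ι : Type*} [DecidableEq ι] (s : Finset ι) {U : Set E}
    (hU : IsOpen U) {x₀ : E} (hx₀ : x₀ ∈ U) (t : ι → E → ℝ) (ht : ∀ i, ContDiffOn ℝ ∞ (t i) U)
    (ht₀ : ∀ i ∈ s, t i x₀ = 0) (e : ι → E)
    (hte : ∀ i ∈ s, ∀ j ∈ s, fderiv ℝ (t i) x₀ (e j) = if i = j then 1 else 0) :
    ∃ V, IsOpen V ∧ x₀ ∈ V ∧ V ⊆ U ∧
      ∀ {G : Type} [NormedAddCommGroup G] [NormedSpace ℝ G] [CompleteSpace G] (u : ι → E → G),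
        (∀ i, ContDiffOn ℝ ∞ (u i) V) → (∀ x ∈ V, ∑ i ∈ s, t i x • u i x = 0) →
        ∃ C : ι → ι → E → G, (∀ i j, ContDiffOn ℝ ∞ (C i j) V) ∧
          (∀ i j, ∀ x ∈ V, C i j x = -C j i x) ∧
          ∀ i ∈ s, ∀ x ∈ V, u i x = ∑ j ∈ s, t j x • C j i x := by
  have : CompleteSpace E := FiniteDimensional.complete ℝ E
  set l : ι → E →L[ℝ] ℝ := fun i => fderiv ℝ (t i) x₀ with hl
  -- This map carries `t i` to the linear form `l i`, exactly and not just to first order, and its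
  -- derivative at `x₀` is the identity.
  set Φ : E → E := fun x => x + ∑ i ∈ s, (t i x - l i x) • e i with hΦ
  have hΦs : ContDiffOn ℝ ∞ Φ U := by
    refine contDiffOn_id.add (ContDiffOn.sum fun i _ => ?_)
    exact ((ht i).sub (l i).contDiff.contDiffOn).smul contDiffOn_const
  have hlΦ : ∀ i ∈ s, ∀ x, l i (Φ x) = t i x := fun i hi x => by
    simp only [hΦ, map_add, map_sum]
    rw [Finset.sum_eq_single_of_mem i hi]
    · rw [map_smul, hte i hi i hi, if_pos rfl, smul_eq_mul]; ring
    · intro j hj hji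
      rw [map_smul, hte i hi j hj, if_neg hji.symm, smul_zero]
  have hΦd : HasFDerivAt Φ ((ContinuousLinearEquiv.refl ℝ E : E ≃L[ℝ] E) : E →L[ℝ] E) x₀ := by
    have h1 : HasFDerivAt Φ (ContinuousLinearMap.id ℝ E +
        ∑ i ∈ s, (l i - l i).smulRight (e i)) x₀ := by
      refine (hasFDerivAt_id x₀).add (HasFDerivAt.fun_sum fun i _ => ?_)
      have h2 : HasFDerivAt (t i) (l i) x₀ := (((ht i).differentiableOn
        (by simp)).differentiableAt (hU.mem_nhds hx₀)).hasFDerivAt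
      exact (h2.sub (l i).hasFDerivAt).smul_const (e i)
    refine h1.congr_fderiv ?_
    ext y
    simp
  have hΦ₀ : ContDiffAt ℝ ∞ Φ x₀ := hΦs.contDiffAt (hU.mem_nhds hx₀)
  set φ := hΦ₀.toOpenPartialHomeomorph Φ hΦd (by simp) with hφ
  have hφΦ : ∀ x, φ x = Φ x := fun x => rfl
  have hxs : x₀ ∈ φ.source := hΦ₀.mem_toOpenPartialHomeomorph_source hΦd (by simp)
  -- Smoothness of the inverse at every point, not just at `Φ x₀`, requires an invertible derivative
  -- there.
  set Ω : Set E := (U ∩ fderiv ℝ Φ ⁻¹' Set.range ((↑) : (E ≃L[ℝ] E) → E →L[ℝ] E)) with hΩ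
  have hΩo : IsOpen Ω := (hΦs.continuousOn_fderiv_of_isOpen hU (by simp)).isOpen_inter_preimage hU
    ContinuousLinearEquiv.isOpen
  have hxΩ : x₀ ∈ Ω := ⟨hx₀, _, hΦd.fderiv.symm⟩
  set W₀ : Set E := φ.target ∩ φ.symm ⁻¹' Ω with hW₀
  have hW₀o : IsOpen W₀ := φ.symm.isOpen_inter_preimage hΩo
  have hφs : ContDiffOn ℝ ∞ φ.symm W₀ := by
    rintro y ⟨hy, hyU, f', hf'⟩
    refine (φ.contDiffAt_symm hy (f₀' := f') ?_
      (hΦs.contDiffAt (hU.mem_nhds hyU))).contDiffWithinAt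
    rw [hf']
    exact ((hΦs.differentiableOn (by simp)).differentiableAt (hU.mem_nhds hyU)).hasFDerivAt
  obtain ⟨W, hWo, hyW, hWW, hW⟩ := exists_koszul_primitive_linear s l e hte
    (y₀ := φ x₀) (fun i hi => by rw [hφΦ, hlΦ i hi, ht₀ i hi]) hW₀o
    ⟨φ.map_source hxs, by rw [Set.mem_preimage, φ.left_inv hxs]; exact hxΩ⟩
  set V : Set E := φ.source ∩ φ ⁻¹' W with hV
  have hVU : V ⊆ U := fun x hx => by
    have := (hWW hx.2).2.1
    rwa [φ.left_inv hx.1] at this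
  have hmaps : Set.MapsTo φ.symm W V := fun y hy =>
    ⟨φ.map_target (hWW hy).1, by rw [Set.mem_preimage, φ.right_inv (hWW hy).1]; exact hy⟩
  refine ⟨V, φ.isOpen_inter_preimage hWo, ⟨hxs, hyW⟩, hVU, ?_⟩
  intro G _ _ _ u hu hsum
  obtain ⟨C, hC, hCa, hCu⟩ := hW (fun i => u i ∘ φ.symm)
    (fun i => (hu i).comp (hφs.mono hWW) hmaps) (fun y hy => by
      rw [← hsum _ (hmaps hy)]
      refine Finset.sum_congr rfl fun i hi => ?_
      rw [← hlΦ i hi, ← hφΦ, φ.right_inv (hWW hy).1, Function.comp_apply])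
  refine ⟨fun i j => C i j ∘ φ, fun i j => (hC i j).comp (hΦs.mono hVU) fun x hx => hx.2,
    fun i j x hx => hCa i j _ hx.2, fun i hi x hx => ?_⟩
  have h := hCu i hi (φ x) hx.2
  rw [Function.comp_apply, φ.left_inv hx.1] at h
  rw [h]
  refine Finset.sum_congr rfl fun j hj => ?_
  rw [hφΦ, hlΦ j hj]
  rfl

end Analysis

/-! ### Smooth inverses and the choice of complementary minors. -/

/-- A smooth family of endomorphisms that is invertible at a point has a smooth inverse nearby. -/
theorem exists_contDiffOn_inverse {E : Type*} [NormedAddCommGroup E] [NormedSpace ℝ E]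
    {W : Type*} [NormedAddCommGroup W] [NormedSpace ℝ W]
    [FiniteDimensional ℝ W] {U : Set E} (hU : IsOpen U) {x₀ : E} (hx₀ : x₀ ∈ U)
    {L : E → W →L[ℝ] W} (hL : ContDiffOn ℝ ∞ L U) (hinj : Function.Injective (L x₀)) :
    ∃ V, IsOpen V ∧ x₀ ∈ V ∧ V ⊆ U ∧ ∃ K : E → W →L[ℝ] W, ContDiffOn ℝ ∞ K V ∧
      ∀ x ∈ V, ∀ y, L x (K x y) = y ∧ K x (L x y) = y := by
  have : CompleteSpace W := FiniteDimensional.complete ℝ W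
  have h0 : IsUnit (L x₀) := by
    let f := (LinearEquiv.ofInjectiveEndo (L x₀ : W →ₗ[ℝ] W) hinj).toContinuousLinearEquiv
    have hf : (f : W →L[ℝ] W) = L x₀ := by ext y; rfl
    exact ⟨ContinuousLinearEquiv.unitsEquiv ℝ W |>.symm f, hf⟩
  refine ⟨U ∩ L ⁻¹' {A | IsUnit A}, hL.continuousOn.isOpen_inter_preimage hU Units.isOpen,
    ⟨hx₀, h0⟩, Set.inter_subset_left, fun x => Ring.inverse (L x), ?_, ?_⟩
  · rintro x ⟨hx, A, hA⟩
    refine ContDiffAt.contDiffWithinAt ?_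
    have h1 := contDiffAt_ringInverse ℝ A (n := ∞)
    rw [hA] at h1
    exact h1.comp x (hL.contDiffAt (hU.mem_nhds hx))
  · rintro x ⟨_, hx⟩ y
    exact ⟨DFunLike.congr_fun (Ring.mul_inverse_cancel _ hx) y,
      DFunLike.congr_fun (Ring.inverse_mul_cancel _ hx) y⟩

/-- If `H * R = 0` and the ranks of `H` and `R` are complementary, there is a set `s` of indices
such that the columns of `H` in `s` are independent and the rows of `R` outside `s` are
independent. -/
theorem exists_complementary_minors {ι κ : Type*} [Fintype ι] [DecidableEq ι] [Fintype κ]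
    (H : Matrix ι ι ℝ) (R : Matrix ι κ ℝ) (hHR : H * R = 0)
    (hrank : H.rank + R.rank = Fintype.card ι) :
    ∃ s : Finset ι,
      (∃ g : ι → ι → ℝ, ∀ i ∈ s, ∀ j ∈ s, ∑ l, g j l * H l i = if i = j then 1 else 0) ∧
      ∀ b, ∃ X : κ → ℝ, b ∉ s → ∀ a ∉ s, ∑ α, R a α * X α = if a = b then 1 else 0 := by
  classical
  obtain ⟨κ', a, ha, hspan, hli⟩ := exists_linearIndependent' ℝ H.col
  have : Finite κ' := Finite.of_injective a ha
  have : Fintype κ' := Fintype.ofFinite κ'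
  set s : Finset ι := Finset.univ.map ⟨a, ha⟩ with hs
  have hsa : (s : Set ι) = Set.range a := by
    rw [hs, Finset.coe_map, Finset.coe_univ, Set.image_univ]; rfl
  refine ⟨s, ?_, ?_⟩
  · have hf : ∀ j : κ', ∃ f : (ι → ℝ) →ₗ[ℝ] ℝ, ∀ i : κ', f (H.col (a i)) = if i = j then 1 else 0 := by
      intro j
      obtain ⟨f, hf⟩ := LinearMap.exists_extend ((Module.Basis.span hli).coord j)
      refine ⟨f, fun i => ?_⟩
      have h1 := DFunLike.congr_fun hf (Module.Basis.span hli i)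
      rw [LinearMap.comp_apply, Module.Basis.coord_apply, Module.Basis.repr_self,
        Finsupp.single_apply] at h1
      rw [← h1]
      congr 1
      rw [Submodule.subtype_apply, Module.Basis.span_apply]
      rfl
    choose f hf using hf
    have hg : ∀ j : ι, ∃ g : ι → ℝ, j ∈ s → ∀ i ∈ s, ∑ l, g l * H l i = if i = j then 1 else 0 := by
      intro j
      by_cases hj : j ∈ s
      · obtain ⟨j, rfl⟩ : j ∈ Set.range a := hsa ▸ hj
        refine ⟨fun l => f j (Pi.single l 1), fun _ i hi => ?_⟩
        obtain ⟨i, rfl⟩ : i ∈ Set.range a := hsa ▸ hi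
        have h2 := hf j i
        simp only [← ha.eq_iff] at h2
        rw [← h2, LinearMap.pi_apply_eq_sum_univ (f j) (H.col (a i))]
        refine Finset.sum_congr rfl fun l _ => ?_
        rw [mul_comm, smul_eq_mul, Matrix.col_apply]
        congr 1
        refine congrArg (f j) ?_
        ext k
        simp [Pi.single_apply, eq_comm]
      · exact ⟨0, fun h => absurd h hj⟩
    choose g hg using hg
    exact ⟨g, fun i hi j hj => hg j hj i hi⟩
  · intro b
    by_cases hb : b ∈ s
    · exact ⟨0, fun h => absurd hb h⟩
    have h1 : H.col b ∈ Submodule.span ℝ (H.col '' s) := by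
      rw [hsa, ← Set.range_comp, hspan]
      exact Submodule.subset_span ⟨b, rfl⟩
    obtain ⟨c, hc⟩ := (Submodule.mem_span_image_finset_iff_exists_fun ℝ).1 h1
    -- One inclusion is `H * R = 0`; the complementary ranks make the dimensions equal.
    have hker : LinearMap.range R.mulVecLin = LinearMap.ker H.mulVecLin := by
      refine Submodule.eq_of_le_of_finrank_eq ?_ ?_
      · rintro _ ⟨x, rfl⟩
        rw [LinearMap.mem_ker, Matrix.mulVecLin_apply, Matrix.mulVecLin_apply,
          Matrix.mulVec_mulVec, hHR, Matrix.zero_mulVec]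
      · have h2 := LinearMap.finrank_range_add_finrank_ker H.mulVecLin
        rw [Module.finrank_fintype_fun_eq_card, ← hrank] at h2
        exact (Nat.add_left_cancel h2).symm
    -- Column `b` of `H` depends on the columns in `s`. The resulting kernel vector agrees with the
    -- unit vector at `b` outside `s`, and it is `R` applied to some `X`.
    have hv : Pi.single b 1 - ∑ i : s, c i • Pi.single (i : ι) (1 : ℝ) ∈
        LinearMap.ker H.mulVecLin := by
      rw [LinearMap.mem_ker, map_sub, map_sum]
      simp only [map_smul, Matrix.mulVecLin_apply, Matrix.mulVec_single_one]
      rw [hc, sub_self]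
    rw [← hker] at hv
    obtain ⟨X, hX⟩ := hv
    refine ⟨X, fun _ a ha => ?_⟩
    have h2 := congrFun hX a
    rw [Matrix.mulVecLin_apply] at h2
    change ∑ α, R a α * X α = _ at h2
    rw [h2, Pi.sub_apply, Finset.sum_apply, Finset.sum_eq_zero, sub_zero, Pi.single_apply]
    rintro ⟨i, hi⟩ _
    rw [Pi.smul_apply, Pi.single_apply, if_neg (fun h : a = i => ha (h ▸ hi)), smul_zero]

/-! ### The algebra of superfunctions. -/

section SmoothRing

variable {p q : ℕ}

theorem ContDiffOn.grassmann_mul {E : Type*} [NormedAddCommGroup E] [NormedSpace ℝ E] {V : Set E}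
    {f g : E → Grassmann q} (hf : ContDiffOn ℝ ∞ f V) (hg : ContDiffOn ℝ ∞ g V) :
    ContDiffOn ℝ ∞ (fun x => f x * g x) V :=
  ((grassmannMul q).contDiff.comp_contDiffOn hf).clm_apply hg

theorem ContDiffOn.linearMap_comp {E F G : Type*} [NormedAddCommGroup E] [NormedSpace ℝ E]
    [NormedAddCommGroup F] [NormedSpace ℝ F] [FiniteDimensional ℝ F] [NormedAddCommGroup G]
    [NormedSpace ℝ G] {V : Set E} {f : E → F} (hf : ContDiffOn ℝ ∞ f V) (φ : F →ₗ[ℝ] G) :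
    ContDiffOn ℝ ∞ (fun x => φ (f x)) V :=
  (LinearMap.toContinuousLinearMap φ).contDiff.comp_contDiffOn hf

/-- The algebra of smooth superfunctions, of any parity, on `V ⊆ ℝ^p`. -/
def superFunctions (V : Set (Fin p → ℝ)) (q : ℕ) : Subalgebra ℝ (V → Grassmann q) where
  carrier := {f | ∃ F : (Fin p → ℝ) → Grassmann q, ContDiffOn ℝ ∞ F V ∧ ∀ x : V, f x = F x}
  mul_mem' := by
    rintro f g ⟨F, hF, hf⟩ ⟨G, hG, hg⟩
    exact ⟨fun x => F x * G x, hF.grassmann_mul hG, fun x => by rw [Pi.mul_apply, hf, hg]⟩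
  add_mem' := by
    rintro f g ⟨F, hF, hf⟩ ⟨G, hG, hg⟩
    exact ⟨fun x => F x + G x, hF.add hG, fun x => by rw [Pi.add_apply, hf, hg]⟩
  algebraMap_mem' := fun r => ⟨fun _ => algebraMap ℝ _ r, contDiffOn_const, fun _ => rfl⟩

namespace superFunctions

variable {V : Set (Fin p → ℝ)}

/-- The superfunction on `V` given by a function that is smooth on `V`. -/
def of (F : (Fin p → ℝ) → Grassmann q) (hF : ContDiffOn ℝ ∞ F V) : superFunctions V q :=
  ⟨fun x => F x, F, hF, fun _ => rfl⟩

theorem of_apply (F : (Fin p → ℝ) → Grassmann q) (hF : ContDiffOn ℝ ∞ F V) (x : V) :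
    (of F hF).1 x = F x := rfl

theorem ext {f g : superFunctions V q} (h : ∀ x, f.1 x = g.1 x) : f = g := Subtype.ext (funext h)

theorem mul_apply (f g : superFunctions V q) (x : V) : (f * g).1 x = f.1 x * g.1 x := rfl

theorem sum_apply {ι : Type*} (s : Finset ι) (f : ι → superFunctions V q) (x : V) :
    (∑ i ∈ s, f i).1 x = ∑ i ∈ s, (f i).1 x := by
  rw [AddSubmonoidClass.coe_finsetSum, Finset.sum_apply]

/-- A linear endomorphism of the Grassmann algebra, applied pointwise. -/
def map (V : Set (Fin p → ℝ)) (φ : Grassmann q →ₗ[ℝ] Grassmann q) :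
    superFunctions V q →ₗ[ℝ] superFunctions V q where
  toFun f := ⟨fun x => φ (f.1 x), by
    obtain ⟨F, hF, hf⟩ := f.2
    exact ⟨fun x => φ (F x), hF.linearMap_comp φ, fun x => congrArg φ (hf x)⟩⟩
  map_add' f g := ext fun x => map_add φ _ _
  map_smul' r f := ext fun x => map_smul φ _ _

theorem map_apply (φ : Grassmann q →ₗ[ℝ] Grassmann q) (f : superFunctions V q) (x : V) :
    (map V φ f).1 x = φ (f.1 x) := rfl

theorem isDegreeProjection (V : Set (Fin p → ℝ)) (q : ℕ) :
    IsDegreeProjection fun d => map V (degreeProj q d) where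
  proj_proj := fun d e z => by
    refine ext fun x => ?_
    rw [map_apply, map_apply, (isDegreeProjection_degreeProj q).proj_proj]
    split_ifs <;> rfl
  proj_neg := fun d hd z => ext fun x => (isDegreeProjection_degreeProj q).proj_neg d hd _
  separated := by
    obtain ⟨N, hN⟩ := (isDegreeProjection_degreeProj q).separated
    exact ⟨N, fun z hz => ext fun x => hN _ fun d hd => congrFun (congrArg Subtype.val (hz d hd)) x⟩
  proj_mul := fun w d z c hz => ext fun x =>
    (isDegreeProjection_degreeProj q).proj_mul w d _ _ (congrFun (congrArg Subtype.val hz) x)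
  filtered := fun a b z c hz hc e he => ext fun x =>
    (isDegreeProjection_degreeProj q).filtered a b _ _
      (fun e he => congrFun (congrArg Subtype.val (hz e he)) x)
      (fun e he => congrFun (congrArg Subtype.val (hc e he)) x) e he

/-- Contraction with the covector field with components `n`. -/
def contract (n : (Fin p → ℝ) → Fin q → ℝ) (hn : ContDiffOn ℝ ∞ n V) :
    superFunctions V q →+ superFunctions V q :=
  ∑ l, (AddMonoidHom.mulLeft (of (fun x => algebraMap ℝ (Grassmann q) (n x l))
    ((contDiffOn_pi.1 hn l).linearMap_comp (Algebra.linearMap ℝ (Grassmann q))))).comp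
      (map V (CliffordAlgebra.contractLeft (LinearMap.proj l))).toAddMonoidHom

theorem contract_apply (n : (Fin p → ℝ) → Fin q → ℝ) (hn : ContDiffOn ℝ ∞ n V)
    (f : superFunctions V q) (x : V) : (contract n hn f).1 x =
      CliffordAlgebra.contractLeft (∑ l, n x l • LinearMap.proj l) (f.1 x) := by
  rw [contract, AddMonoidHom.finsetSum_apply, sum_apply, map_sum, LinearMap.sum_apply]
  refine Finset.sum_congr rfl fun l _ => ?_
  rw [map_smul, LinearMap.smul_apply, Algebra.smul_def]
  rfl

end superFunctions

theorem degreeProj_eq_zero_of_body {z : Grassmann q} (hz : body z = 0) {e : ℤ} (he : e < 1) :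
    degreeProj q e z = 0 := by
  rcases lt_or_ge e 0 with h | h
  · exact degreeProj_of_neg h z
  · obtain rfl : e = 0 := by omega
    rw [degreeProj_zero, hz, map_zero]

theorem body_sum {ι : Type*} (s : Finset ι) (f : ι → Grassmann q) :
    body (∑ i ∈ s, f i) = ∑ i ∈ s, body (f i) := map_sum (bodyLinear q) f s

theorem body_smul (r : ℝ) (z : Grassmann q) : body (r • z) = r * body z :=
  map_smul (bodyLinear q) r z

theorem body_one : body (1 : Grassmann q) = 1 := map_one ExteriorAlgebra.algebraMapInv

/-- A matrix of superfunctions whose body is the identity at a point has a smooth right inverse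
nearby. -/
theorem exists_matrix_right_inverse {κ : Type*} [Fintype κ] [DecidableEq κ]
    {U : Set (Fin p → ℝ)} (hU : IsOpen U) {x₀ : Fin p → ℝ} (hx₀ : x₀ ∈ U)
    (M : κ → κ → (Fin p → ℝ) → Grassmann q) (hM : ∀ a b, ContDiffOn ℝ ∞ (M a b) U)
    (hM₀ : ∀ a b, body (M a b x₀) = if a = b then 1 else 0) :
    ∃ V, IsOpen V ∧ x₀ ∈ V ∧ V ⊆ U ∧ ∃ Y : κ → κ → (Fin p → ℝ) → Grassmann q,
      (∀ a b, ContDiffOn ℝ ∞ (Y a b) V) ∧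
      ∀ x ∈ V, ∀ a c, ∑ b, M a b x * Y b c x = if a = c then 1 else 0 := by
  -- Left multiplication by the matrix, as a real linear endomorphism; its inverse applied to unit
  -- vectors gives the columns of the right inverse.
  set L : (Fin p → ℝ) → (κ → Grassmann q) →L[ℝ] (κ → Grassmann q) := fun x =>
    ∑ a, ∑ b, (ContinuousLinearMap.single ℝ (fun _ : κ => Grassmann q) a).comp
      ((grassmannMul q (M a b x)).comp (ContinuousLinearMap.proj b)) with hLdef
  have hLa : ∀ x y a, L x y a = ∑ b, M a b x * y b := fun x y a => by
    simp only [hLdef, _root_.sum_apply, Finset.sum_apply, ContinuousLinearMap.comp_apply,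
      ContinuousLinearMap.single_apply, grassmannMul_apply, ContinuousLinearMap.proj_apply]
    rw [Finset.sum_eq_single a]
    · simp
    · intro c _ hc
      exact Finset.sum_eq_zero fun b _ => Pi.single_eq_of_ne hc.symm _
    · simp
  have hLs : ContDiffOn ℝ ∞ L U := ContDiffOn.sum fun a _ => ContDiffOn.sum fun b _ =>
    contDiffOn_const.clm_comp
      (((grassmannMul q).contDiff.comp_contDiffOn (hM a b)).clm_comp contDiffOn_const)
  have hinj : Function.Injective (L x₀) := by
    refine (injective_iff_map_eq_zero _).2 fun y hy => ?_
    have hQ := isDegreeProjection_degreeProj q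
    obtain ⟨N, hN⟩ := hQ.separated
    -- `M - 1` has zero body at `x₀`, so it raises the degree: iterating this fixed-point equation
    -- pushes a kernel vector beyond every degree.
    have hya : ∀ a, y a = -∑ b, (M a b x₀ - if a = b then 1 else 0) * y b := fun a => by
      have h := congrFun hy a
      rw [hLa] at h
      simp only [sub_mul, Finset.sum_sub_distrib, h, ite_mul, one_mul, zero_mul,
        Finset.sum_ite_eq, Finset.mem_univ, if_true, Pi.zero_apply, zero_sub, neg_neg]
    have key : ∀ n : ℕ, ∀ a, ∀ e < (n : ℤ), degreeProj q e (y a) = 0 := by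
      intro n
      induction n with
      | zero => exact fun a e he => hQ.proj_neg e (by simpa using he) _
      | succ n ih =>
        intro a e he
        rw [hya a, map_neg, map_sum, neg_eq_zero]
        refine Finset.sum_eq_zero fun b _ => hQ.filtered 1 n _ _
          (fun e he => degreeProj_eq_zero_of_body ?_ he) (ih b) e (by push_cast at he; linarith)
        rw [← bodyLinear_apply, map_sub, bodyLinear_apply, hM₀, bodyLinear_apply]
        split_ifs
        · rw [body_one, sub_self]
        · rw [← bodyLinear_apply, map_zero, sub_self]
    ext1 a
    exact hN _ fun d hd => key N.toNat a d (lt_of_lt_of_le hd (Int.self_le_toNat N))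
  obtain ⟨V, hV, hxV, hVU, K, hK, hLK⟩ := exists_contDiffOn_inverse hU hx₀ hLs hinj
  refine ⟨V, hV, hxV, hVU, fun b c x => K x (Pi.single c 1) b, fun b c => ?_, fun x hx a c => ?_⟩
  · exact contDiffOn_pi.1 (hK.clm_apply contDiffOn_const) b
  · rw [← hLa, (hLK x hx _).1, Pi.single_apply]

end SmoothRing

/-! ### Derivatives of superfunctions and of the Noether identity. -/

section Derivatives

variable {p q : ℕ} {U : Set (Fin p → ℝ)}

theorem fderiv_linearMap_comp {E F G : Type*} [NormedAddCommGroup E] [NormedSpace ℝ E]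
    [NormedAddCommGroup F] [NormedSpace ℝ F] [FiniteDimensional ℝ F] [NormedAddCommGroup G]
    [NormedSpace ℝ G] (φ : F →ₗ[ℝ] G) {f : E → F} {x : E} (hf : DifferentiableAt ℝ f x) (v : E) :
    fderiv ℝ (fun x => φ (f x)) x v = φ (fderiv ℝ f x v) := by
  have h := (LinearMap.toContinuousLinearMap φ).hasFDerivAt.comp x hf.hasFDerivAt
  exact DFunLike.congr_fun h.fderiv v

theorem IsSuperFunctionOn.differentiableAt {ε : ZMod 2} {f : (Fin p → ℝ) → Grassmann q}
    (hf : IsSuperFunctionOn U ε f) (hU : IsOpen U) {x : Fin p → ℝ} (hx : x ∈ U) :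
    DifferentiableAt ℝ f x :=
  (hf.smooth.differentiableOn (by simp)).differentiableAt (hU.mem_nhds hx)

/-- The right derivative of a superfunction is a superfunction. -/
theorem IsSuperFunctionOn.rightDeriv {ε : ZMod 2} {f : (Fin p → ℝ) → Grassmann q}
    (hf : IsSuperFunctionOn U ε f) (hU : IsOpen U) (i : FieldIndex p q) :
    IsSuperFunctionOn U (ε + fieldParity i) (rightDeriv i f) := by
  rcases i with k | a
  · refine ⟨(hf.smooth.fderiv_of_isOpen hU (by simp)).clm_apply contDiffOn_const, fun x hx => ?_⟩
    change fderiv ℝ f x _ ∈ CliffordAlgebra.evenOdd _ (ε + 0)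
    rw [add_zero]
    -- The component of `f` of the opposite parity vanishes near `x`, hence so does that of its
    -- derivative.
    refine mem_evenOdd_of_parityProj ?_
    rw [← fderiv_linearMap_comp _ (hf.differentiableAt hU hx)]
    have h : (fun x => parityProj q (ε + 1) (f x)) =ᶠ[nhds x] fun _ => 0 := by
      filter_upwards [hU.mem_nhds hx] with y hy using parityProj_add_of_mem (hf.parity y hy)
    rw [h.fderiv_eq]
    simp
  · exact ⟨hf.smooth.linearMap_comp
      ((CliffordAlgebra.contractRight (Q := (0 : QuadraticForm ℝ (Fin q → ℝ)))).flip
        (LinearMap.proj a)), fun x hx => contractRight_mem_evenOdd (hf.parity x hx) _⟩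

theorem body_leftDeriv_inl {f : (Fin p → ℝ) → Grassmann q} {x : Fin p → ℝ}
    (hf : DifferentiableAt ℝ f x) (k : Fin p) :
    body (leftDeriv (Sum.inl k) f x) = fderiv ℝ (fun x => body (f x)) x (Pi.single k 1) :=
  (fderiv_linearMap_comp (bodyLinear q) hf _).symm

theorem body_leftDeriv_inr (f : (Fin p → ℝ) → Grassmann q) (x : Fin p → ℝ) (l : Fin q) :
    body (leftDeriv (Sum.inr l) f x) = ExteriorAlgebra.ιInv (f x) l :=
  body_contractLeft _ _

/-- On the common zeros of the bodies of `T i`, the derivatives of the relation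
`∑ i, T i * R i = 0`. -/
theorem sum_body_leftDeriv_mul {ι : Type*} [Fintype ι] (hU : IsOpen U)
    {T R : ι → (Fin p → ℝ) → Grassmann q} (hT : ∀ i, ContDiffOn ℝ ∞ (T i) U)
    (hR : ∀ i, ContDiffOn ℝ ∞ (R i) U) (hTR : ∀ x ∈ U, ∑ i, T i x * R i x = 0)
    {x : Fin p → ℝ} (hx : x ∈ U) (hTx : ∀ i, body (T i x) = 0) (l : FieldIndex p q) :
    ∑ i, body (leftDeriv l (T i) x) * body (R i x) = 0 := by
  have hd : ∀ {f : (Fin p → ℝ) → Grassmann q}, ContDiffOn ℝ ∞ f U → DifferentiableAt ℝ f x :=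
    fun hf => (hf.differentiableOn (by simp)).differentiableAt (hU.mem_nhds hx)
  rcases l with k | l
  · have hb : ∀ {f : (Fin p → ℝ) → Grassmann q}, ContDiffOn ℝ ∞ f U →
        HasFDerivAt (fun x => body (f x)) (fderiv ℝ (fun x => body (f x)) x) x := fun hf =>
      (((hf.linearMap_comp (bodyLinear q)).differentiableOn (by simp)).differentiableAt
        (hU.mem_nhds hx)).hasFDerivAt
    have h1 := HasFDerivAt.fun_sum (u := Finset.univ) fun i _ => (hb (hT i)).mul (hb (hR i))
    have h2 : HasFDerivAt (fun y => ∑ i, body (T i y) * body (R i y))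
        (0 : (Fin p → ℝ) →L[ℝ] ℝ) x := by
      refine (hasFDerivAt_const (0 : ℝ) x).congr_of_eventuallyEq ?_
      filter_upwards [hU.mem_nhds hx] with y hy
      simp only [← body_mul]
      rw [← body_sum, hTR y hy]
      exact map_zero (bodyLinear q)
    have h3 := DFunLike.congr_fun (h1.unique h2) (Pi.single k 1)
    simp only [hTx, _root_.sum_apply, zero_smul, zero_add, _root_.smul_apply, smul_eq_mul,
      _root_.zero_apply] at h3
    rw [← h3]
    refine Finset.sum_congr rfl fun i _ => ?_
    rw [body_leftDeriv_inl (hd (hT i)), mul_comm]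
  -- For an odd direction the linear part of the relation replaces its derivative.
  · have h := congrFun (congrArg ExteriorAlgebra.ιInv (hTR x hx)) l
    rw [map_sum, map_zero, Finset.sum_apply] at h
    refine Eq.trans ?_ h
    refine Finset.sum_congr rfl fun i _ => ?_
    rw [body_leftDeriv_inr, ιInv_mul]
    change _ = (body (T i x) • _ + body (R i x) • _ : Fin q → ℝ) l
    rw [hTx, zero_smul, zero_add, Pi.smul_apply, smul_eq_mul, mul_comm]

end Derivatives

/-! ### Generators of the ideal of the equations of motion. -/

section Main

variable {p q m₀ m₁ : ℕ} {U : Set (Fin p → ℝ)}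

theorem fieldParity_eq_zero_or_one (i : FieldIndex p q) : fieldParity i = 0 ∨ fieldParity i = 1 := by
  rcases i with _ | _ <;> simp [fieldParity]

/-- Koszul exactness on `V` of the right derivatives of `S₀`, together with the generation of the
ideal of all right derivatives, yields a graded antisymmetric structure function on `V`. -/
theorem exists_antisymm_structureFunction {ε₀ : Fin m₀ → ZMod 2} {ε₁ : Fin m₁ → ZMod 2}
    {T : FieldIndex p q → (Fin p → ℝ) → Grassmann q}
    {R : FieldIndex p q → Fin m₀ → (Fin p → ℝ) → Grassmann q}
    {Z : Fin m₀ → Fin m₁ → (Fin p → ℝ) → Grassmann q}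
    {B : FieldIndex p q → FieldIndex p q → Fin m₁ → (Fin p → ℝ) → Grassmann q}
    {V : Set (Fin p → ℝ)}
    (hT : ∀ i, IsSuperFunctionOn V (fieldParity i) (T i))
    (hR : ∀ i α, IsSuperFunctionOn V (fieldParity i + ε₀ α) (R i α))
    (hZ : ∀ α β, IsSuperFunctionOn V (ε₀ α + ε₁ β) (Z α β))
    (hTR : ∀ x ∈ V, ∀ α, ∑ i, T i x * R i α x = 0)
    (hB : ∀ i j β, ContDiffOn ℝ ∞ (B i j β) V)
    (hRZ : ∀ x ∈ V, ∀ i β, ∑ α, R i α x * Z α β x = ∑ j, T j x * B j i β x)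
    (s : Finset (FieldIndex p q))
    (hs : IsKoszulExact fieldParity (fun i => superFunctions.of (T i) (hT i).smooth) s)
    (hgen : ∀ a ∉ s, ∃ K : FieldIndex p q → superFunctions V q,
      superFunctions.of (T a) (hT a).smooth =
        ∑ j ∈ s, superFunctions.of (T j) (hT j).smooth * K j) :
    ∃ B' : FieldIndex p q → FieldIndex p q → Fin m₁ → (Fin p → ℝ) → Grassmann q,
      IsBStructureFunctionOn V ε₁ B' ∧ IsGradedAntisymmOn V B' ∧
      ∀ x ∈ V, ∀ i β, ∑ α, R i α x * Z α β x = ∑ j, T j x * B' j i β x := by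
  have key : ∀ β, ∃ C : FieldIndex p q → FieldIndex p q → superFunctions V q,
      IsGradedAntisymm fieldParity C ∧ ∀ i, ∑ α, superFunctions.of (R i α) (hR i α).smooth *
        superFunctions.of (Z α β) (hZ α β).smooth =
        ∑ j, superFunctions.of (T j) (hT j).smooth * C j i := by
    intro β
    refine hs.exists_isGradedAntisymm (fun i j => superFunctions.ext fun x => ?_) hgen
      (fun i j => superFunctions.of (B i j β) (hB i j β)) (fun i => superFunctions.ext fun x => ?_)
      (superFunctions.ext fun x => ?_)
    · exact mul_eq_koszulSign_smul ((hT i).parity x x.2) ((hT j).parity x x.2)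
    · rw [superFunctions.sum_apply, superFunctions.sum_apply]
      exact hRZ x x.2 i β
    · simp only [superFunctions.sum_apply, superFunctions.mul_apply, superFunctions.of_apply,
        Finset.mul_sum, ← mul_assoc]
      rw [Finset.sum_comm]
      refine Finset.sum_eq_zero fun α _ => ?_
      rw [← Finset.sum_mul, hTR x x.2 α, zero_mul]
  choose C hCa hC using key
  choose F hF hCF using fun β i j => (C β i j).2
  -- The primitive may have mixed parity. Projection preserves antisymmetry, the target parity being
  -- symmetric in `i` and `j`, and it preserves the identity, `T j` being homogeneous.
  refine ⟨fun i j β x => parityProj q (fieldParity i + fieldParity j + ε₁ β) (F β i j x),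
    fun i j β => ⟨(hF β i j).linearMap_comp _, fun x _ => parityProj_mem _ _⟩,
    fun x hx i j β => ?_, fun x hx i β => ?_⟩
  · have h := congrFun (congrArg Subtype.val (hCa β i j)) ⟨x, hx⟩
    change (C β i j).1 ⟨x, hx⟩ = -(koszulSign _ _ • (C β j i).1 ⟨x, hx⟩) at h
    rw [hCF, hCF] at h
    change F β i j x = -(koszulSign _ _ • F β j i x) at h
    beta_reduce
    rw [h, map_neg, map_smul, add_comm (fieldParity i)]
  · have h := congrFun (congrArg Subtype.val (hC β i)) ⟨x, hx⟩
    simp only [superFunctions.sum_apply, superFunctions.mul_apply, superFunctions.of_apply,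
      hCF] at h
    have hpar : ∑ α, R i α x * Z α β x ∈
        CliffordAlgebra.evenOdd (0 : QuadraticForm ℝ (Fin q → ℝ)) (fieldParity i + ε₁ β) := by
      refine Submodule.sum_mem _ fun α _ => ?_
      have h1 := SetLike.mul_mem_graded ((hR i α).parity x hx) ((hZ α β).parity x hx)
      have h2 : ∀ a b c : ZMod 2, a + b + (b + c) = a + c := by decide
      rwa [h2] at h1
    rw [← parityProj_of_mem hpar, h, map_sum]
    refine Finset.sum_congr rfl fun j _ => ?_
    have h3 : ∀ a b c : ZMod 2, a + c = b + (b + a + c) := by decide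
    rw [h3 (fieldParity i) (fieldParity j), parityProj_mul_of_mem ((hT j).parity x hx)]

theorem IsSuperFunctionOn.mono {ε : ZMod 2} {f : (Fin p → ℝ) → Grassmann q} {V : Set (Fin p → ℝ)}
    (hf : IsSuperFunctionOn U ε f) (hVU : V ⊆ U) : IsSuperFunctionOn V ε f :=
  ⟨hf.smooth.mono hVU, fun x hx => hf.parity x (hVU hx)⟩

/-- Near a point where the body of some `T k` does not vanish, `T k` generates the unit ideal. -/
theorem exists_koszulExact_of_body_ne_zero (hU : IsOpen U)
    {T : FieldIndex p q → (Fin p → ℝ) → Grassmann q}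
    (hT : ∀ i, IsSuperFunctionOn U (fieldParity i) (T i)) {x₀ : Fin p → ℝ} (hx₀ : x₀ ∈ U)
    {k : FieldIndex p q} (hk : body (T k x₀) ≠ 0) :
    ∃ (V : Set (Fin p → ℝ)) (_ : IsOpen V) (_ : x₀ ∈ V) (hVU : V ⊆ U)
      (s : Finset (FieldIndex p q)),
      IsKoszulExact fieldParity
        (fun i => superFunctions.of (V := V) (T i) ((hT i).smooth.mono hVU)) s ∧
      ∀ a ∉ s, ∃ K : FieldIndex p q → superFunctions V q,
        superFunctions.of (T a) ((hT a).smooth.mono hVU) =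
          ∑ j ∈ s, superFunctions.of (T j) ((hT j).smooth.mono hVU) * K j := by
  have hk0 : fieldParity k = 0 := (fieldParity_eq_zero_or_one k).resolve_right fun h =>
    hk (body_of_mem_odd (h ▸ (hT k).parity x₀ hx₀))
  obtain ⟨V, hV, hxV, hVU, Y, hY, hMY⟩ := exists_matrix_right_inverse (κ := Unit) hU hx₀
    (fun _ _ x => (body (T k x₀))⁻¹ • T k x) (fun _ _ => (hT k).smooth.const_smul _)
    (fun _ _ => by rw [body_smul, inv_mul_cancel₀ hk, if_pos rfl])
  set τ := superFunctions.of (V := V) (T k) ((hT k).smooth.mono hVU) with hτ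
  set y := superFunctions.of (V := V) (fun x => (body (T k x₀))⁻¹ • Y () () x)
    ((hY () ()).const_smul _) with hy
  have h1 : τ * y = 1 := superFunctions.ext fun x => by
    have h := hMY x x.2 () ()
    rw [Finset.univ_unique, Finset.sum_singleton, if_pos rfl] at h
    change T k x * ((body (T k x₀))⁻¹ • Y () () x) = 1
    rw [mul_smul_comm, ← smul_mul_assoc]
    exact h
  have h2 : y * τ = 1 := by
    rw [← h1]
    exact superFunctions.ext fun x =>
      (commute_of_mem_even (hk0 ▸ (hT k).parity x (hVU x.2)) _).symm
  -- A relation for an invertible `T k` forces `u k = 0`, so the zero matrix is a primitive.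
  refine ⟨V, hV, hxV, hVU, {k}, fun u hu => ⟨0, isGradedAntisymm_zero _, fun i hi => ?_⟩,
    fun a _ => ⟨fun _ => y * superFunctions.of (T a) ((hT a).smooth.mono hVU), ?_⟩⟩
  · rw [Finset.mem_singleton.1 hi]
    rw [Finset.sum_singleton] at hu
    have h3 : u k = y * (τ * u k) := by rw [← mul_assoc, h2, one_mul]
    rw [h3, hu]
    simp
  · rw [Finset.sum_singleton, ← mul_assoc, h1, one_mul]

/-- Near a point where the rows of the body of `R` outside `s` are independent, the relations
`∑ i, T i * R i α = 0` express all `T a` in terms of the `T j`, `j ∈ s`. -/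
theorem exists_generation_of_relations (hU : IsOpen U)
    {T : FieldIndex p q → (Fin p → ℝ) → Grassmann q}
    {R : FieldIndex p q → Fin m₀ → (Fin p → ℝ) → Grassmann q}
    (hT : ∀ i, ContDiffOn ℝ ∞ (T i) U) (hR : ∀ i α, ContDiffOn ℝ ∞ (R i α) U)
    (hTR : ∀ x ∈ U, ∀ α, ∑ i, T i x * R i α x = 0) {x₀ : Fin p → ℝ} (hx₀ : x₀ ∈ U)
    (s : Finset (FieldIndex p q)) (X : FieldIndex p q → Fin m₀ → ℝ)
    (hX : ∀ b ∉ s, ∀ a ∉ s, ∑ α, body (R a α x₀) * X b α = if a = b then 1 else 0) :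
    ∃ V, IsOpen V ∧ x₀ ∈ V ∧ V ⊆ U ∧ ∀ W (hWU : W ⊆ U), W ⊆ V → ∀ a ∉ s,
      ∃ K : FieldIndex p q → superFunctions W q,
        superFunctions.of (T a) ((hT a).mono hWU) =
          ∑ j ∈ s, superFunctions.of (T j) ((hT j).mono hWU) * K j := by
  have hN : ∀ (i b : FieldIndex p q), ContDiffOn ℝ ∞ (fun x => ∑ α, X b α • R i α x) U :=
    fun i b => ContDiffOn.sum fun α _ => (hR i α).const_smul _
  obtain ⟨V, hV, hxV, hVU, Y, hY, hMY⟩ := exists_matrix_right_inverse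
    (κ := {a // a ∉ s}) hU hx₀ (fun a b x => ∑ α, X b α • R a α x) (fun a b => hN a b)
    (fun a b => by
      rw [body_sum]
      simp only [body_smul, mul_comm (X _ _)]
      rw [hX b b.2 a a.2]
      simp only [Subtype.ext_iff])
  refine ⟨V, hV, hxV, hVU, fun W hWU hWV c hc => ?_⟩
  refine ⟨fun j => superFunctions.of
    (fun x => -∑ b : {a // a ∉ s}, (∑ α, X b α • R j α x) * Y b ⟨c, hc⟩ x)
    (ContDiffOn.neg (ContDiffOn.sum fun b _ => ((hN j b).mono hWU).grassmann_mul
      ((hY b _).mono hWV))), superFunctions.ext fun x => ?_⟩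
  simp only [superFunctions.sum_apply, superFunctions.mul_apply, superFunctions.of_apply]
  -- The relations combined with coefficients `X b`: the block outside `s` has identity body at
  -- `x₀`, so it can be inverted and the system solved for the `T a`.
  have h1 : ∀ b, ∑ a : {a // a ∉ s}, T a x * ∑ α, X b α • R a α x =
      -∑ j ∈ s, T j x * ∑ α, X b α • R j α x := fun b => by
    rw [eq_neg_iff_add_eq_zero, add_comm]
    have h2 : ∑ a : {a // a ∉ s}, T a x * ∑ α, X b α • R a α x =
        ∑ a ∈ sᶜ, T a x * ∑ α, X b α • R a α x :=
      (Finset.sum_subtype sᶜ (fun a => Finset.mem_compl)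
        fun a => T a x * ∑ α, X b α • R a α x).symm
    rw [h2, Finset.sum_add_sum_compl]
    simp only [Finset.mul_sum, mul_smul_comm]
    rw [Finset.sum_comm]
    refine Finset.sum_eq_zero fun α _ => ?_
    rw [← Finset.smul_sum, hTR x (hWU x.2) α, smul_zero]
  have h3 : ∀ a : {a // a ∉ s}, ∑ b : {a // a ∉ s}, (∑ α, X b α • R a α x) * Y b ⟨c, hc⟩ x =
      if a = ⟨c, hc⟩ then 1 else 0 := fun a => hMY x (hWV x.2) a ⟨c, hc⟩
  set N : FieldIndex p q → FieldIndex p q → Grassmann q := fun j b => ∑ α, X b α • R j α x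
  change ∀ b, ∑ a : {a // a ∉ s}, T a x * N a b = -∑ j ∈ s, T j x * N j b at h1
  change ∀ a : {a // a ∉ s}, ∑ b : {a // a ∉ s}, N a b * Y b ⟨c, hc⟩ x = _ at h3
  change _ = ∑ j ∈ s, T j x * -∑ b : {a // a ∉ s}, N j b * Y b ⟨c, hc⟩ x
  calc T c x = ∑ a : {a // a ∉ s}, T a x * if a = ⟨c, hc⟩ then 1 else 0 := by simp
    _ = ∑ a : {a // a ∉ s}, T a x * ∑ b : {a // a ∉ s}, N a b * Y b ⟨c, hc⟩ x :=
        Finset.sum_congr rfl fun a _ => by rw [h3]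
    _ = ∑ b : {a // a ∉ s}, (∑ a : {a // a ∉ s}, T a x * N a b) * Y b ⟨c, hc⟩ x := by
        simp only [Finset.mul_sum, Finset.sum_mul, ← mul_assoc]
        rw [Finset.sum_comm]
    _ = _ := by
        simp only [h1, neg_mul, mul_neg, Finset.sum_mul, Finset.mul_sum, ← mul_assoc,
          Finset.sum_neg_distrib]
        rw [Finset.sum_comm]

/-- Covector fields dual to vector fields that are independent at a point. -/
theorem exists_dual_covectors {ι : Type*} [DecidableEq ι] (hU : IsOpen U) {x₀ : Fin p → ℝ}
    (hx₀ : x₀ ∈ U) (s : Finset ι) (m : ι → (Fin p → ℝ) → Fin q → ℝ)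
    (hm : ∀ i, ContDiffOn ℝ ∞ (m i) U) (g : ι → Fin q → ℝ)
    (hg : ∀ i ∈ s, ∀ j ∈ s, ∑ l, g j l * m i x₀ l = if i = j then 1 else 0) :
    ∃ V, IsOpen V ∧ x₀ ∈ V ∧ V ⊆ U ∧ ∃ n : ι → (Fin p → ℝ) → Fin q → ℝ,
      (∀ i, ContDiffOn ℝ ∞ (n i) V) ∧
      ∀ x ∈ V, ∀ i ∈ s, ∀ j ∈ s, ∑ l, n j x l * m i x l = if i = j then 1 else 0 := by
  -- With `q = 0` the Grassmann algebra is the real line, so this is the inverse of an ordinary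
  -- matrix of functions.
  obtain ⟨V, hV, hxV, hVU, Y, hY, hMY⟩ := exists_matrix_right_inverse (q := 0) (κ := s) hU hx₀
    (fun a b x => algebraMap ℝ (Grassmann 0) (∑ l, g b l * m a x l))
    (fun a b => ContDiffOn.linearMap_comp (ContDiffOn.sum fun l _ =>
      contDiffOn_const.mul (contDiffOn_pi.1 (hm a) l)) (Algebra.linearMap ℝ (Grassmann 0)))
    (fun a b => by
      rw [body_algebraMap, hg a a.2 b b.2]
      simp only [Subtype.ext_iff])
  refine ⟨V, hV, hxV, hVU, fun c x l => if hc : c ∈ s then ∑ b : s, body (Y b ⟨c, hc⟩ x) * g b l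
    else 0, fun c => ?_, fun x hx a ha c hc => ?_⟩
  · by_cases hc : c ∈ s
    · simp only [hc, dif_pos]
      exact contDiffOn_pi.2 fun l => ContDiffOn.sum fun b _ =>
        ((hY b ⟨c, hc⟩).linearMap_comp (bodyLinear 0)).mul contDiffOn_const
    · simp only [hc, dif_neg, not_false_eq_true]
      exact contDiffOn_const
  · have h := congrArg body (hMY x hx ⟨a, ha⟩ ⟨c, hc⟩)
    rw [body_sum] at h
    simp only [body_mul, body_algebraMap, Subtype.mk.injEq] at h
    simp only [hc, dif_pos]
    have h2 : body (if a = c then (1 : Grassmann 0) else 0) = if a = c then 1 else 0 := by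
      split_ifs
      · exact body_one
      · exact map_zero (bodyLinear 0)
    rw [← h2, ← h]
    simp only [Finset.sum_mul]
    rw [Finset.sum_comm]
    refine Finset.sum_congr rfl fun b _ => Finset.sum_congr rfl fun l _ => ?_
    ring

end Main

/-! ### Exactness for superfunctions with independent differentials. -/

section Leading

variable {p q : ℕ} {U V : Set (Fin p → ℝ)}

/-- The lowest degree in the Grassmann generators allowed by the parity of a field. -/
def fieldDegree (i : FieldIndex p q) : ℤ := if fieldParity i = 0 then 0 else 1

theorem fieldDegree_of_even {i : FieldIndex p q} (hi : fieldParity i = 0) : fieldDegree i = 0 :=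
  if_pos hi

theorem fieldDegree_of_odd {i : FieldIndex p q} (hi : fieldParity i = 1) : fieldDegree i = 1 := by
  rw [fieldDegree, hi]; rfl

/-- The part of lowest degree of a superfunction with the parity of `φ^i`. -/
def leadingPart (V : Set (Fin p → ℝ)) (i : FieldIndex p q) (f : superFunctions V q) :
    superFunctions V q := superFunctions.map V (degreeProj q (fieldDegree i)) f

theorem leadingPart_apply_of_even {i : FieldIndex p q} (hi : fieldParity i = 0)
    (f : superFunctions V q) (x : V) :
    (leadingPart V i f).1 x = algebraMap ℝ _ (body (f.1 x)) := by
  rw [leadingPart, superFunctions.map_apply, fieldDegree_of_even hi, degreeProj_zero]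

theorem leadingPart_apply_of_odd {i : FieldIndex p q} (hi : fieldParity i = 1)
    (f : superFunctions V q) (x : V) :
    (leadingPart V i f).1 x = ExteriorAlgebra.ι ℝ (ExteriorAlgebra.ιInv (f.1 x)) := by
  rw [leadingPart, superFunctions.map_apply, fieldDegree_of_odd hi, degreeProj_one]

theorem leadingPart_mem (i : FieldIndex p q) (f : superFunctions V q) (x : V) :
    (leadingPart V i f).1 x ∈
      CliffordAlgebra.evenOdd (0 : QuadraticForm ℝ (Fin q → ℝ)) (fieldParity i) := by
  rcases fieldParity_eq_zero_or_one i with hi | hi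
  · rw [leadingPart_apply_of_even hi, hi]
    exact SetLike.algebraMap_mem_graded _ _
  · rw [leadingPart_apply_of_odd hi, hi]
    exact CliffordAlgebra.ι_mem_evenOdd_one _ _

/-- Koszul exactness of superfunctions follows from that of their parts of lowest degree. -/
theorem isKoszulExact_of_leadingPart {T : FieldIndex p q → superFunctions V q}
    (hT : ∀ i x, (T i).1 x ∈
      CliffordAlgebra.evenOdd (0 : QuadraticForm ℝ (Fin q → ℝ)) (fieldParity i))
    {s : Finset (FieldIndex p q)}
    (h : IsKoszulExact fieldParity (fun i => leadingPart V i (T i)) s) :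
    IsKoszulExact fieldParity T s := by
  have hw : ∀ i : FieldIndex p q, fieldDegree i = 0 ∨ fieldDegree i = 1 := fun i =>
    (fieldParity_eq_zero_or_one i).imp fieldDegree_of_even fieldDegree_of_odd
  refine IsKoszulExact.of_leading (superFunctions.isDegreeProjection V q) fieldDegree
    (fun i => by rcases hw i with h | h <;> simp [h])
    (fun i => by rcases hw i with h | h <;> simp [h])
    (fun i _ j _ => superFunctions.ext fun x => mul_eq_koszulSign_smul (hT i x) (hT j x))
    (fun i _ => ?_) (fun i _ e he => ?_) h
  · exact ((superFunctions.isDegreeProjection V q).proj_proj _ _ _).trans (if_pos rfl)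
  · rw [map_sub, sub_eq_zero]
    refine Eq.trans ?_ ((superFunctions.isDegreeProjection V q).proj_proj e (fieldDegree i) _).symm
    split_ifs with h
    · rw [h]
    · refine superFunctions.ext fun x => ?_
      have he' := lt_of_le_of_ne he h
      rw [superFunctions.map_apply]
      rcases fieldParity_eq_zero_or_one i with hi | hi
      · rw [fieldDegree_of_even hi] at he'
        exact degreeProj_of_neg he' _
      · rw [fieldDegree_of_odd hi] at he'
        exact degreeProj_eq_zero_of_body (body_of_mem_odd (hi ▸ hT i x)) he'

/-- Koszul exactness of the bodies of the even superfunctions in a family. -/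
theorem isKoszulExact_leadingPart_even {T : FieldIndex p q → superFunctions V q}
    {t : FieldIndex p q → (Fin p → ℝ) → ℝ} (hTt : ∀ i (x : V), body ((T i).1 x) = t i x)
    {s : Finset (FieldIndex p q)} (hs : ∀ i ∈ s, fieldParity i = 0)
    (h : ∀ u : FieldIndex p q → (Fin p → ℝ) → Grassmann q, (∀ i, ContDiffOn ℝ ∞ (u i) V) →
      (∀ x ∈ V, ∑ i ∈ s, t i x • u i x = 0) →
      ∃ C : FieldIndex p q → FieldIndex p q → (Fin p → ℝ) → Grassmann q,
        (∀ i j, ContDiffOn ℝ ∞ (C i j) V) ∧ (∀ i j, ∀ x ∈ V, C i j x = -C j i x) ∧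
        ∀ i ∈ s, ∀ x ∈ V, u i x = ∑ j ∈ s, t j x • C j i x) :
    IsKoszulExact fieldParity (fun i => leadingPart V i (T i)) s := by
  intro u hu
  have hlead : ∀ i ∈ s, ∀ x c, (leadingPart V i (T i) * c).1 x = t i x • c.1 x := fun i hi x c => by
    rw [superFunctions.mul_apply, leadingPart_apply_of_even (hs i hi), hTt, ← Algebra.smul_def]
  choose F hF huF using fun i => (u i).2
  obtain ⟨C, hC, hCa, hCu⟩ := h F hF (fun x hx => by
    have h1 := congrFun (congrArg Subtype.val hu) ⟨x, hx⟩
    rw [superFunctions.sum_apply] at h1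
    refine Eq.trans (Finset.sum_congr rfl fun i hi => ?_) h1
    rw [hlead i hi, huF])
  -- Antisymmetry is required for all indices. Outside `s` the sign may be that of odd fields, so
  -- the entries there are set to zero.
  refine ⟨fun i j => if i ∈ s ∧ j ∈ s then superFunctions.of (C i j) (hC i j) else 0,
    fun i j => ?_, fun i hi => superFunctions.ext fun x => ?_⟩
  · beta_reduce
    by_cases hij : i ∈ s ∧ j ∈ s
    · rw [if_pos hij, if_pos hij.symm, hs i hij.1, koszulSign_zero_left, one_smul]
      exact superFunctions.ext fun x => hCa i j x x.2
    · rw [if_neg hij, if_neg fun h => hij h.symm, smul_zero, neg_zero]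
  · rw [superFunctions.sum_apply, huF, hCu i hi x x.2]
    refine Finset.sum_congr rfl fun j hj => ?_
    beta_reduce
    rw [hlead j hj, if_pos ⟨hj, hi⟩, superFunctions.of_apply]

/-- Adjoining the linear parts of odd superfunctions that are dual to a covector field. -/
theorem IsKoszulExact.union_odd {T : FieldIndex p q → superFunctions V q}
    {s t : Finset (FieldIndex p q)} (hs : ∀ i ∈ s, fieldParity i = 0)
    (ht : ∀ i ∈ t, fieldParity i = 1) {n : FieldIndex p q → (Fin p → ℝ) → Fin q → ℝ}
    (hn : ∀ i, ContDiffOn ℝ ∞ (n i) V)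
    (hnT : ∀ x : V, ∀ i ∈ t, ∀ j ∈ t, ∑ l, n j x l * ExteriorAlgebra.ιInv ((T i).1 x) l =
      if i = j then 1 else 0)
    (h : IsKoszulExact fieldParity (fun i => leadingPart V i (T i)) s) :
    IsKoszulExact fieldParity (fun i => leadingPart V i (T i)) (s ∪ t) := by
  -- Contraction is a graded derivation, and duality of the covectors makes it select one odd linear
  -- part.
  have hD : ∀ i ∈ t, ∀ j ∈ t, ∀ c, superFunctions.contract (n j) (hn j)
      (leadingPart V i (T i) * c) =
        (if i = j then c else 0) - leadingPart V i (T i) * superFunctions.contract (n j) (hn j) c := by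
    intro i hi j hj c
    refine superFunctions.ext fun x => ?_
    have h1 : (if i = j then c else 0 : superFunctions V q).1 x =
        (if i = j then (1 : ℝ) else 0) • c.1 x := by
      split_ifs
      · rw [one_smul]
      · rw [zero_smul]; rfl
    change _ = (if i = j then c else 0 : superFunctions V q).1 x - _ * _
    rw [h1, superFunctions.contract_apply, superFunctions.contract_apply,
      superFunctions.mul_apply, leadingPart_apply_of_odd (ht i hi),
      CliffordAlgebra.contractLeft_ι_mul, ← hnT x i hi j hj]
    congr 2
    simp [LinearMap.sum_apply]
  have hDs : ∀ i ∈ s, ∀ j, ∀ c, superFunctions.contract (n j) (hn j)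
      (leadingPart V i (T i) * c) =
        leadingPart V i (T i) * superFunctions.contract (n j) (hn j) c := by
    intro i hi j c
    refine superFunctions.ext fun x => ?_
    rw [superFunctions.contract_apply, superFunctions.mul_apply, superFunctions.mul_apply,
      leadingPart_apply_of_even (hs i hi), CliffordAlgebra.contractLeft_algebraMap_mul,
      superFunctions.contract_apply]
  have key : ∀ r ⊆ t, IsKoszulExact fieldParity (fun i => leadingPart V i (T i)) (s ∪ r) := by
    intro r
    induction r using Finset.induction_on with
    | empty => exact fun _ => by rwa [Finset.union_empty]
    | insert k r hk ih =>
      intro hr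
      have hkt : k ∈ t := hr (Finset.mem_insert_self k r)
      have hrt : r ⊆ t := fun i hi => hr (Finset.mem_insert_of_mem hi)
      rw [Finset.union_insert]
      refine (ih hrt).insert_odd ?_ (ht k hkt)
        (fun i _ => superFunctions.ext fun x =>
          mul_eq_koszulSign_smul (leadingPart_mem _ _ _) (leadingPart_mem _ _ _))
        (superFunctions.ext fun x => ?_) (superFunctions.contract (n k) (hn k))
        (fun i hi c => ?_) (fun c => ?_)
      · intro h
        rcases Finset.mem_union.1 h with h | h
        · have := (hs k h).symm.trans (ht k hkt)
          exact absurd this (by decide)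
        · exact hk h
      · rw [superFunctions.mul_apply, leadingPart_apply_of_odd (ht k hkt)]
        exact ExteriorAlgebra.ι_sq_zero _
      · rcases Finset.mem_union.1 hi with h | h
        · exact ⟨_, hDs i h k c⟩
        · refine ⟨-superFunctions.contract (n k) (hn k) c, ?_⟩
          rw [hD i (hrt h) k hkt, if_neg (fun h' : i = k => hk (h' ▸ h)), zero_sub]
          exact (mul_neg (leadingPart V i (T i)) _).symm
      · rw [hD k hkt k hkt, if_pos rfl]
  exact key t (Finset.Subset.refl t)

/-- Superfunctions with independent differentials at a common zero of their bodies have an exact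
Koszul complex nearby. -/
theorem exists_koszulExact_of_independent (hU : IsOpen U)
    {T : FieldIndex p q → (Fin p → ℝ) → Grassmann q}
    (hT : ∀ i, IsSuperFunctionOn U (fieldParity i) (T i)) {x₀ : Fin p → ℝ} (hx₀ : x₀ ∈ U)
    (hTx : ∀ i, body (T i x₀) = 0) (s : Finset (FieldIndex p q))
    (g : FieldIndex p q → FieldIndex p q → ℝ)
    (hg : ∀ i ∈ s, ∀ j ∈ s, ∑ l, g j l * body (leftDeriv l (T i) x₀) = if i = j then 1 else 0) :
    ∃ (V : Set (Fin p → ℝ)) (_ : IsOpen V) (_ : x₀ ∈ V) (hVU : V ⊆ U),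
      IsKoszulExact fieldParity
        (fun i => superFunctions.of (V := V) (T i) ((hT i).smooth.mono hVU)) s := by
  -- By parity the independence condition splits into even and odd blocks: the former concerns
  -- differentials of bodies, the latter linear parts.
  have heven : ∀ i, fieldParity i = 0 → ∀ l, body (leftDeriv (Sum.inr l) (T i) x₀) = 0 :=
    fun i hi l => by
      rw [body_leftDeriv_inr, ιInv_of_mem_even (hi ▸ (hT i).parity x₀ hx₀), Pi.zero_apply]
  have hodd : ∀ i, fieldParity i = 1 → ∀ k, body (leftDeriv (Sum.inl k) (T i) x₀) = 0 :=
    fun i hi k => by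
      rw [body_leftDeriv_inl ((hT i).differentiableAt hU hx₀)]
      have h : (fun x => body (T i x)) =ᶠ[nhds x₀] fun _ => 0 := by
        filter_upwards [hU.mem_nhds hx₀] with y hy using body_of_mem_odd (hi ▸ (hT i).parity y hy)
      rw [h.fderiv_eq]
      simp
  obtain ⟨V₁, hV₁, hxV₁, hVU₁, n, hn, hnT⟩ := exists_dual_covectors hU hx₀
    (s.filter fun i => fieldParity i = 1) (fun i x => ExteriorAlgebra.ιInv (T i x))
    (fun i => (hT i).smooth.linearMap_comp ExteriorAlgebra.ιInv) (fun j l => g j (Sum.inr l))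
    (fun i hi j hj => by
      rw [Finset.mem_filter] at hi hj
      rw [← hg i hi.1 j hj.1, Fintype.sum_sum_type]
      simp only [hodd i hi.2, mul_zero, Finset.sum_const_zero, zero_add, body_leftDeriv_inr])
  obtain ⟨V, hV, hxV, hVV, hK⟩ := exists_koszul_primitive
    (s.filter fun i => fieldParity i = 0) hV₁ hxV₁ (fun i x => body (T i x))
    (fun i => ((hT i).smooth.mono hVU₁).linearMap_comp (bodyLinear q)) (fun i _ => hTx i)
    (fun j l => g j (Sum.inl l)) (fun i hi j hj => by
      rw [Finset.mem_filter] at hi hj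
      rw [← hg i hi.1 j hj.1, Fintype.sum_sum_type]
      simp only [heven i hi.2, mul_zero, Finset.sum_const_zero, add_zero]
      rw [← ContinuousLinearMap.coe_coe, LinearMap.pi_apply_eq_sum_univ]
      refine Finset.sum_congr rfl fun k _ => ?_
      rw [body_leftDeriv_inl ((hT i).differentiableAt hU hx₀), smul_eq_mul,
        ContinuousLinearMap.coe_coe]
      congr 2
      ext l
      simp [Pi.single_apply, eq_comm])
  have hVU := hVV.trans hVU₁
  refine ⟨V, hV, hxV, hVU, isKoszulExact_of_leadingPart (fun i x => (hT i).parity x (hVU x.2)) ?_⟩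
  have hsplit : s = (s.filter fun i => fieldParity i = 0) ∪ s.filter fun i => fieldParity i = 1 := by
    rw [← Finset.filter_or, Finset.filter_true_of_mem fun i _ => fieldParity_eq_zero_or_one i]
  rw [hsplit]
  exact IsKoszulExact.union_odd (fun i hi => (Finset.mem_filter.1 hi).2)
    (fun i hi => (Finset.mem_filter.1 hi).2) (fun i => (hn i).mono hVV)
    (fun x => hnT x (hVV x.2))
    (isKoszulExact_leadingPart_even (fun i x => rfl) (fun i hi => (Finset.mem_filter.1 hi).2)
      fun u hu => hK u hu)

end Leading

end

/-! ### Assembly: points on and off the stationary surface. -/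

theorem mainTheorem11 {p q m₀ m₁ : ℕ} (ε₀ : Fin m₀ → ZMod 2) (ε₁ : Fin m₁ → ZMod 2)
    (U : Set (Fin p → ℝ)) (hU : IsOpen U)
    (S₀ : (Fin p → ℝ) → Grassmann q) (hS₀ : IsSuperFunctionOn U 0 S₀)
    (R : FieldIndex p q → Fin m₀ → (Fin p → ℝ) → Grassmann q)
    (hR : ∀ i α, IsSuperFunctionOn U (fieldParity i + ε₀ α) (R i α))
    (Z : Fin m₀ → Fin m₁ → (Fin p → ℝ) → Grassmann q)
    (hZ : ∀ α β, IsSuperFunctionOn U (ε₀ α + ε₁ β) (Z α β))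
    (hNoether : NoetherIdentity U S₀ R)
    (Mhess MR : ℕ) (hM : Mhess + MR = p + q)
    (hrankS₀ : ∀ x ∈ stationarySurface U S₀, superRankAt (superHessian S₀) x = Mhess)
    (hrankR : ∀ x ∈ stationarySurface U S₀, superRankAt R x = MR)
    (B : FieldIndex p q → FieldIndex p q → Fin m₁ → (Fin p → ℝ) → Grassmann q)
    (hB : IsBStructureFunctionOn U ε₁ B)
    (hNoether₁ : FirstStageNoetherIdentity U S₀ R Z B) :
    ∀ x ∈ U, ∃ V : Set (Fin p → ℝ), IsOpen V ∧ x ∈ V ∧ V ⊆ U ∧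
      ∃ B' : FieldIndex p q → FieldIndex p q → Fin m₁ → (Fin p → ℝ) → Grassmann q,
        IsBStructureFunctionOn V ε₁ B' ∧ IsGradedAntisymmOn V B' ∧
        FirstStageNoetherIdentity V S₀ R Z B' := by
  set T : FieldIndex p q → (Fin p → ℝ) → Grassmann q := fun i => rightDeriv i S₀ with hTdef
  have hT : ∀ i, IsSuperFunctionOn U (fieldParity i) (T i) := fun i => by
    simpa only [zero_add] using hS₀.rightDeriv hU i
  intro x₀ hx₀
  -- It remains to find, near each point, generators of the ideal of the `T i` with exact Koszul
  -- complex.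
  suffices h : ∃ (V : Set (Fin p → ℝ)) (_ : IsOpen V) (_ : x₀ ∈ V) (hVU : V ⊆ U)
      (s : Finset (FieldIndex p q)),
      IsKoszulExact fieldParity
        (fun i => superFunctions.of (V := V) (T i) ((hT i).smooth.mono hVU)) s ∧
      ∀ a ∉ s, ∃ K : FieldIndex p q → superFunctions V q,
        superFunctions.of (T a) ((hT a).smooth.mono hVU) =
          ∑ j ∈ s, superFunctions.of (T j) ((hT j).smooth.mono hVU) * K j by
    obtain ⟨V, hV, hxV, hVU, s, hs, hgen⟩ := h
    exact ⟨V, hV, hxV, hVU, exists_antisymm_structureFunction (fun i => (hT i).mono hVU)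
      (fun i α => (hR i α).mono hVU) (fun α β => (hZ α β).mono hVU)
      (fun x hx => hNoether x (hVU hx)) (fun i j β => (hB i j β).smooth.mono hVU)
      (fun x hx => hNoether₁ x (hVU hx)) s hs hgen⟩
  by_cases hstat : ∀ i, body (T i x₀) = 0
  · have hxs : x₀ ∈ stationarySurface U S₀ := ⟨hx₀, hstat⟩
    obtain ⟨s, ⟨g, hg⟩, hX⟩ := exists_complementary_minors
      (Matrix.of fun i j => body (superHessian S₀ i j x₀)) (Matrix.of fun i j => body (R i j x₀))
      (by
        ext l α
        exact sum_body_leftDeriv_mul hU (fun i => (hT i).smooth) (fun i => (hR i α).smooth)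
          (fun x hx => hNoether x hx α) hx₀ hstat l)
      (by
        have h1 := hrankS₀ x₀ hxs
        have h2 := hrankR x₀ hxs
        rw [superRankAt] at h1 h2
        rw [h1, h2, hM, Fintype.card_sum, Fintype.card_fin, Fintype.card_fin])
    choose X hX using hX
    obtain ⟨V₁, hV₁, hxV₁, hVU₁, hgen⟩ := exists_generation_of_relations hU
      (fun i => (hT i).smooth) (fun i α => (hR i α).smooth) hNoether hx₀ s X hX
    obtain ⟨V, hV, hxV, hVV, hs⟩ := exists_koszulExact_of_independent hV₁
      (fun i => (hT i).mono hVU₁) hxV₁ hstat s g hg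
    exact ⟨V, hV, hxV, hVV.trans hVU₁, s, hs, hgen V (hVV.trans hVU₁) hVV⟩
  · obtain ⟨k, hk⟩ := not_forall.1 hstat
    exact exists_koszulExact_of_body_ne_zero hU hT hx₀ hk
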